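/- **Setting.** For $n,p,k\in\mathbb N$, $\sigma>0$, $r\ge 0$ and $\mathcal D\subseteq\mathbb R$ with $\beta_{\min}:=\inf\{|b|:b\in\mathcal D\}>0$, let $\mathcal P_r(\mathcal D)$ be the class of joint laws $\pi$ of two signals $(\beta_1,\beta_2)$ in $\mathbb R^p$ such that each of $\beta_1,\beta_2$ almost surely has exactly $k$ nonzero entries, all in $\mathcal D$, and Euclidean norm $r$, and has a support that is uniformly distributed over the $k$-element subsets of $\{1,\dots,p\}$. In the symmetric balanced detection problem SBMSLRD one has $\pi\in\mathcal P_r(\mathcal D)$ with $\beta_1=-\beta_2$ almost surely, and one tests, from data $(X,y)\in\mathbb R^{n\times p}\times\mathbb R^n$ (so $N=n(p+1)$ real numbers), $$\mathbf P:\; y=\tfrac1\sigma X\beta_1\odot z+\tfrac1\sigma X\beta_2\odot(1-z)+w\qquad\text{against}\qquad \mathbf Q:\; y=\sqrt{r^2/\sigma^2+1}\;w,$$ where $X$ has i.i.d. $\mathcal N(0,1)$ entries, $w_i\sim\mathcal N(0,1)$ and $z_i\sim\mathrm{Bernoulli}(1/2)$ are i.i.d., and $X$, $w$, $z$, $(\beta_1,\beta_2)\sim\pi$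 are independent. Put $\mathrm{SNR}=r^2/\sigma^2$. The degree-$D$ chi-square divergence is $$\chi^2_{\le D}(\mathbf P\|\mathbf Q)=\sup_{f}\frac{(\mathbb E_{\mathbf P}f)^2}{\mathbb E_{\mathbf Q}f^2}-1,$$ with the supremum over real polynomials $f\neq0$ of degree at most $D$ in the data. **Theorem.** (1) There is an absolute constant $M$ such that for all such $n,p,k,\sigma,r,\mathcal D,\pi$, every $B$ with $\|\beta_1\|_\infty\le B$ almost surely, and every $D\in\mathbb N$: if $k\le\sqrt{p/e}$ and $$k\le D\le 2(\sqrt2-1)\min\left\{\frac{(r^2+\sigma^2)^2}{nB^4},\,n\right\},$$ then $\chi^2_{\le D}(\mathbf P\|\mathbf Q)\le M$. (2) For every $K$ there is $c=c(K)>0$ such that the following holds for every sequence of SBMSLRD problems with parameters $(p,n,k,\sigma,r,\mathcal D,\pi)=(p_i,n_i,k_i,\sigma_i,r_i,\mathcal D_i,\pi_i)$, $i\to\infty$, that has bounded amplitude ($\|\beta_1\|_\infty\le K\beta_{\min}$ almost surely) and satisfies $p\to\infty$, $k=o(\sqrt p)$, $n=\omega(\max\{k,\log p\})$ and $$n=o\left(\frac{k^2(\mathrm{SNR}+1)^2}{\mathrm{SNR}^2}\cdot\frac1{\log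 p}\right).$$ Let $m=\min\left\{\frac{k^2(\mathrm{SNR}+1)^2}{n\,\mathrm{SNR}^2},\,n\right\}$. (a) For all degrees $D=D_i\in\mathbb N$ with $D\le c\,m$ for all large $i$, $\chi^2_{\le D}(\mathbf P\|\mathbf Q)=O(1)$. (b) Suppose moreover that $\log n=O(\log p)$, and that the low-degree conjecture holds for this sequence of problems, that is, for all degrees $D=\omega(\log N)$ with $\chi^2_{\le D}(\mathbf P\|\mathbf Q)=O(1)$, strong detection requires running time $\exp(\tilde\Omega(D))$. Then strong detection requires running time $\exp(\tilde\Omega(m))$. Here "strong detection requires running time $\exp(\tilde\Omega(f))$" means: whenever a randomized algorithm, within $T_i$ steps, decides for $\mathbf P$ with probability $1-o(1)$ under $\mathbf P$ and for $\mathbf Q$ with probability $1-o(1)$ under $\mathbf Q$, there are $c'>0$ and $a\in\mathbb N$ with $T_i\ge\exp\left(c' f_i/(\log N_i)^a\right)$ for all large $i$. A randomized algorithm is a fixed finite program of a real random access machine (unit-cost arithmetic and comparisons of real numbers, counters and indirect addressing by natural numbers, fresh standard Gaussian random numbers) whose input is $p,n,k,\sigma,r$ and the data. -/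

import Mathlib

open MeasureTheory ProbabilityTheory Filter Topology Asymptotics
open scoped ENNReal NNReal Matrix

noncomputable section

namespace MSLR

/-! ### The degree-`D` chi-square divergence -/

/-- The contribution `(E_P f)² / E_Q f²` of a test function `f` (with the conventions of `ℝ≥0∞`:
`0 / 0 = 0` and `a / 0 = ∞` for `a ≠ 0`).  If `f` has no expectation under `P`, the value is `∞`. -/
def testRatio {N : ℕ} (P Q : Measure (Fin N → ℝ)) (f : (Fin N → ℝ) → ℝ) : ℝ≥0∞ :=
  open Classical in
  if Integrable f P then
    ENNReal.ofReal ((∫ x, f x ∂P) ^ 2) / ∫⁻ x, ENNReal.ofReal (f x ^ 2) ∂Q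
  else ∞

/-- The degree-`D` chi-square divergence
`χ²_{≤ D}(P ‖ Q) = sup_f (E_P f)² / E_Q f² - 1`, the supremum being over the real polynomials `f` of
total degree at most `D` that lie in `L²(Q)`.  If `P ≪ Q` and `L = dP/dQ` is in `L²(Q)`, this is
`E_Q (L^{≤ D})² - 1`, where `L^{≤ D}` is the orthogonal projection of `L` to these polynomials. -/
def chiSqLE {N : ℕ} (D : ℕ) (P Q : Measure (Fin N → ℝ)) : ℝ≥0∞ :=
  (⨆ (f : MvPolynomial (Fin N) ℝ) (_ : f.totalDegree ≤ D)
      (_ : MemLp (fun x => MvPolynomial.eval x f) 2 Q),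
      testRatio P Q (fun x => MvPolynomial.eval x f)) - 1

/-! ### The detection problem for mixed sparse linear regression -/

/-- The Euclidean norm of a vector (the norm of `Fin p → ℝ` in Mathlib is the sup norm). -/
def l2norm {p : ℕ} (β : Fin p → ℝ) : ℝ := Real.sqrt (∑ j, β j ^ 2)

/-- The support of a vector. -/
def supp {p : ℕ} (β : Fin p → ℝ) : Finset (Fin p) := Finset.univ.filter fun j => β j ≠ 0

/-- `β_min`, the infimum of `|β|` over the set `𝒟` of admissible nonzero entries. -/
def bMin (𝒟 : Set ℝ) : ℝ := sInf ((fun b : ℝ => |b|) '' 𝒟)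

/-- A law on `ℝ^p` of `k`-sparse signals of Euclidean norm `r` with nonzero entries in `𝒟`, whose
support is uniform over the `k`-element subsets of the coordinates.  No restriction is
put on the law of the nonzero entries given the support, so that the uniform law on a finite set of
all such vectors is an instance. -/
structure IsSignalLaw {p : ℕ} (k : ℕ) (r : ℝ) (𝒟 : Set ℝ) (μ : Measure (Fin p → ℝ)) : Prop where
  prob : IsProbabilityMeasure μ
  sparse : ∀ᵐ β ∂μ, (supp β).card = k
  norm_eq : ∀ᵐ β ∂μ, l2norm β = r
  entries : ∀ᵐ β ∂μ, ∀ j, β j ≠ 0 → β j ∈ 𝒟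
  supp_uniform : ∀ S : Finset (Fin p), S.card = k →
    μ {β | supp β = S} = ((p.choose k : ℕ) : ℝ≥0∞)⁻¹

/-- The joint priors `𝒫_r(𝒟)` of two signals: `β_min > 0` and both marginals are as above. -/
structure IsJointPrior {p : ℕ} (k : ℕ) (r : ℝ) (𝒟 : Set ℝ)
    (π : Measure ((Fin p → ℝ) × (Fin p → ℝ))) : Prop where
  bMin_pos : 0 < bMin 𝒟
  fst : IsSignalLaw k r 𝒟 (π.map Prod.fst)
  snd : IsSignalLaw k r 𝒟 (π.map Prod.snd)

/-- The law of an `n × p` design with independent standard Gaussian entries. -/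
def designLaw (n p : ℕ) : Measure (Fin n → Fin p → ℝ) :=
  Measure.pi fun _ => Measure.pi fun _ => gaussianReal 0 1

/-- The law of `n` independent standard Gaussian noise variables. -/
def noiseLaw (n : ℕ) : Measure (Fin n → ℝ) := Measure.pi fun _ => gaussianReal 0 1

/-- The law of `n` independent Bernoulli(`φ`) labels, as real numbers. -/
def labelLaw (n : ℕ) (φ : ℝ) : Measure (Fin n → ℝ) :=
  Measure.pi fun _ =>
    ENNReal.ofReal φ • Measure.dirac (1 : ℝ) + ENNReal.ofReal (1 - φ) • Measure.dirac (0 : ℝ)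

/-- The `n × (p + 1)` matrix `[X y]`, row by row, as a vector of length `n (p + 1)`. -/
def dataVec {n p : ℕ} (X : Fin n → Fin p → ℝ) (y : Fin n → ℝ) : Fin (n * (p + 1)) → ℝ :=
  fun s => Fin.snoc (α := fun _ => ℝ) (X (finProdFinEquiv.symm s).1) (y (finProdFinEquiv.symm s).1)
    (finProdFinEquiv.symm s).2

/-- The planted response `y = σ⁻¹ X β₁ ⊙ z + σ⁻¹ X β₂ ⊙ (1 - z) + w`. -/
def response {n p : ℕ} (σ : ℝ) (X : Fin n → Fin p → ℝ) (β₁ β₂ : Fin p → ℝ) (z w : Fin n → ℝ) :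
    Fin n → ℝ :=
  fun i => σ⁻¹ * (∑ j, X i j * β₁ j) * z i + σ⁻¹ * (∑ j, X i j * β₂ j) * (1 - z i) + w i

/-- The planted law `P(X, y)`: `X`, `(β₁, β₂) ∼ π`, the labels and the noise are independent. -/
def planted (n : ℕ) {p : ℕ} (σ φ : ℝ) (π : Measure ((Fin p → ℝ) × (Fin p → ℝ))) :
    Measure (Fin (n * (p + 1)) → ℝ) :=
  ((designLaw n p).prod (π.prod ((labelLaw n φ).prod (noiseLaw n)))).map fun t =>
    dataVec t.1 (response σ t.1 t.2.1.1 t.2.1.2 t.2.2.1 t.2.2.2)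

/-- The null law `P(X) ⊗ P(y)`: `X` and `y = √(r²/σ² + 1) w` are independent. -/
def null (n p : ℕ) (σ r : ℝ) : Measure (Fin (n * (p + 1)) → ℝ) :=
  ((designLaw n p).prod (noiseLaw n)).map fun t =>
    dataVec t.1 fun i => Real.sqrt (r ^ 2 / σ ^ 2 + 1) * t.2 i

/-! ### Randomized algorithms on real data -/

/-- Instructions of a randomized real random access machine.  It has registers `I[0], I[1], …` with
natural numbers, used for counting and addressing, and `R[0], R[1], …` with real numbers. -/
inductive Instr where
  /-- `I[d] := c` -/
  | natConst (d c : ℕ)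
  /-- `I[d] := I[a] + I[b]` -/
  | natAdd (d a b : ℕ)
  /-- `I[d] := I[a] - I[b]` (or `0` if this is negative) -/
  | natSub (d a b : ℕ)
  /-- `I[d] := I[I[a]]` -/
  | natLoad (d a : ℕ)
  /-- `I[I[a]] := I[b]` -/
  | natStore (a b : ℕ)
  /-- `R[d] := c` -/
  | realConst (d : ℕ) (c : ℝ)
  /-- `R[d] := R[a] + R[b]` -/
  | realAdd (d a b : ℕ)
  /-- `R[d] := R[a] - R[b]` -/
  | realSub (d a b : ℕ)
  /-- `R[d] := R[a] * R[b]` -/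
  | realMul (d a b : ℕ)
  /-- `R[d] := R[a] / R[b]` (or `0` if `R[b] = 0`) -/
  | realDiv (d a b : ℕ)
  /-- `R[d] := R[I[a]]` -/
  | realLoad (d a : ℕ)
  /-- `R[I[a]] := R[b]` -/
  | realStore (a b : ℕ)
  /-- `R[d] :=` a fresh independent standard Gaussian random number -/
  | gauss (d : ℕ)
  /-- go to line `l` if `I[a] = 0` -/
  | jumpNat (a l : ℕ)
  /-- go to line `l` if `0 < R[a]` -/
  | jumpReal (a l : ℕ)
  /-- halt, deciding for the planted law -/
  | accept
  /-- halt, deciding for the null law -/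
  | reject

/-- A program is a finite list of instructions; it is the same for all input sizes. -/
abbrev Program := List Instr

/-- A configuration: program counter, registers, number of random numbers used, verdict. -/
structure Config where
  pc : ℕ
  I : ℕ → ℕ
  R : ℕ → ℝ
  used : ℕ
  verdict : Option Bool

/-- The effect of one instruction; `ω` is the sequence of random numbers. -/
def Instr.exec (ω : ℕ → ℝ) (s : Config) : Instr → Config
  | .natConst d c => { s with pc := s.pc + 1, I := Function.update s.I d c }
  | .natAdd d a b => { s with pc := s.pc + 1, I := Function.update s.I d (s.I a + s.I b) }
  | .natSub d a b => { s with pc := s.pc + 1, I := Function.update s.I d (s.I a - s.I b) }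
  | .natLoad d a => { s with pc := s.pc + 1, I := Function.update s.I d (s.I (s.I a)) }
  | .natStore a b => { s with pc := s.pc + 1, I := Function.update s.I (s.I a) (s.I b) }
  | .realConst d c => { s with pc := s.pc + 1, R := Function.update s.R d c }
  | .realAdd d a b => { s with pc := s.pc + 1, R := Function.update s.R d (s.R a + s.R b) }
  | .realSub d a b => { s with pc := s.pc + 1, R := Function.update s.R d (s.R a - s.R b) }
  | .realMul d a b => { s with pc := s.pc + 1, R := Function.update s.R d (s.R a * s.R b) }
  | .realDiv d a b => { s with pc := s.pc + 1, R := Function.update s.R d (s.R a / s.R b) }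
  | .realLoad d a => { s with pc := s.pc + 1, R := Function.update s.R d (s.R (s.I a)) }
  | .realStore a b => { s with pc := s.pc + 1, R := Function.update s.R (s.I a) (s.R b) }
  | .gauss d =>
      { s with pc := s.pc + 1, R := Function.update s.R d (ω s.used), used := s.used + 1 }
  | .jumpNat a l => { s with pc := if s.I a = 0 then l else s.pc + 1 }
  | .jumpReal a l => open Classical in { s with pc := if 0 < s.R a then l else s.pc + 1 }
  | .accept => { s with verdict := some true }
  | .reject => { s with verdict := some false }

/-- One step; a halted machine stays as it is, and so does one whose counter left the program. -/
def step (A : Program) (ω : ℕ → ℝ) (s : Config) : Config :=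
  if s.verdict.isSome then s
  else match A[s.pc]? with
    | some c => c.exec ω s
    | none => s

/-- The starting configuration with the given lists in the first registers (and `0` elsewhere). -/
def startConfig (nats : List ℕ) (reals : List ℝ) : Config where
  pc := 0
  I := fun j => nats.getD j 0
  R := fun j => reals.getD j 0
  used := 0
  verdict := none

/-- The verdict that `A` has reached after `T` steps, if any. -/
def verdictAfter (A : Program) (T : ℕ) (nats : List ℕ) (reals : List ℝ) (ω : ℕ → ℝ) :
    Option Bool :=
  ((step A ω)^[T] (startConfig nats reals)).verdict

/-- The law of the sequence of random numbers. -/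
def seedLaw : Measure (ℕ → ℝ) := Measure.infinitePi fun _ => gaussianReal 0 1

/-! ### Strong detection and the low-degree conjecture -/

/-- A sequence of simple hypothesis testing problems, `P i` against `Q i` on `ℝ^(N i)`, with the
parameters `nats i` and `reals i` of the `i`-th problem known to the tester. -/
structure TestingProblem where
  N : ℕ → ℕ
  P : ∀ i, Measure (Fin (N i) → ℝ)
  Q : ∀ i, Measure (Fin (N i) → ℝ)
  nats : ℕ → List ℕ
  reals : ℕ → List ℝ

namespace TestingProblem

/-- The verdict of the program `A` after `t` steps on the data `x` for the `i`-th problem. -/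
def run (𝒯 : TestingProblem) (A : Program) (i t : ℕ) (x : Fin (𝒯.N i) → ℝ) (ω : ℕ → ℝ) :
    Option Bool :=
  verdictAfter A t (𝒯.nats i) (𝒯.reals i ++ List.ofFn x) ω

/-- The randomized algorithm `A` achieves strong detection in running time `T`: within `T i` steps
it decides correctly with probability `1 - o(1)`, under `P i` as well as under `Q i`. -/
def StronglyDetects (𝒯 : TestingProblem) (A : Program) (T : ℕ → ℕ) : Prop :=
  Tendsto (fun i => ((𝒯.P i).prod seedLaw) {t | 𝒯.run A i (T i) t.1 t.2 = some true})
    atTop (𝓝 1) ∧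
  Tendsto (fun i => ((𝒯.Q i).prod seedLaw) {t | 𝒯.run A i (T i) t.1 t.2 = some false})
    atTop (𝓝 1)

/-- Strong detection requires running time `exp(Ω̃(f))`, with `Ω̃` up to factors that are
polylogarithmic in the problem size `N`. -/
def RequiresExpTime (𝒯 : TestingProblem) (f : ℕ → ℝ) : Prop :=
  ∀ (A : Program) (T : ℕ → ℕ), 𝒯.StronglyDetects A T →
    ∃ (c : ℝ) (a : ℕ), 0 < c ∧
      ∀ᶠ i in atTop, Real.exp (c * f i / Real.log (𝒯.N i) ^ a) ≤ (T i : ℝ)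

/-- `χ²_{≤ D}(P ‖ Q) = O(1)`. -/
def ChiSqBounded (𝒯 : TestingProblem) (D : ℕ → ℕ) : Prop :=
  ∃ M : ℝ≥0, ∀ᶠ i in atTop, chiSqLE (D i) (𝒯.P i) (𝒯.Q i) ≤ M

/-- What the low-degree conjecture (for strong detection) says of the problem `𝒯`: if
`χ²_{≤ D}(P ‖ Q) = O(1)` for some `D = ω(log N)`, then strong detection requires running time
`exp(Ω̃(D))`. -/
def LowDegreeConjecture (𝒯 : TestingProblem) : Prop :=
  ∀ D : ℕ → ℕ, (fun i => Real.log (𝒯.N i)) =o[atTop] (fun i => (D i : ℝ)) →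
    𝒯.ChiSqBounded D → 𝒯.RequiresExpTime fun i => (D i : ℝ)

end TestingProblem

/-! ### Sequences of symmetric balanced problems -/

/-- The parameters and signal priors of a sequence of problems. -/
structure Params where
  p : ℕ → ℕ
  n : ℕ → ℕ
  k : ℕ → ℕ
  σ : ℕ → ℝ
  /-- the Euclidean norm of the signals -/
  r : ℕ → ℝ
  𝒟 : ℕ → Set ℝ
  π : ∀ i, Measure ((Fin (p i) → ℝ) × (Fin (p i) → ℝ))

namespace Params

/-- The signal-to-noise ratio. -/
def snr (S : Params) (i : ℕ) : ℝ := S.r i ^ 2 / S.σ i ^ 2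

/-- `k² (SNR + 1)² / SNR²`. -/
def nAlg (S : Params) (i : ℕ) : ℝ := (S.k i : ℝ) ^ 2 * (S.snr i + 1) ^ 2 / S.snr i ^ 2

/-- `min {k² (SNR + 1)² / (n SNR²), n}`. -/
def rate (S : Params) (i : ℕ) : ℝ := min (S.nAlg i / S.n i) (S.n i)

/-- The detection problem with mixture parameter `1/2`. -/
def problem (S : Params) : TestingProblem where
  N i := S.n i * (S.p i + 1)
  P i := planted (S.n i) (S.σ i) (1 / 2) (S.π i)
  Q i := null (S.n i) (S.p i) (S.σ i) (S.r i)
  nats i := [S.p i, S.n i, S.k i]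
  reals i := [S.σ i, S.r i]

/-- The symmetric balanced problem (`β₁ = -β₂`) in the regime `p → ∞`, `k = o(√p)`,
`n = ω(max {k, log p})` and `n = o(k² (SNR + 1)² / (SNR² log p))`, with signals of bounded amplitude:
`‖β‖_∞ ≤ K β_min` (the sup norm). -/
structure InRegime (S : Params) (K : ℝ) : Prop where
  σ_pos : ∀ i, 0 < S.σ i
  prior : ∀ i, IsJointPrior (S.k i) (S.r i) (S.𝒟 i) (S.π i)
  symmetric : ∀ i, ∀ᵐ b ∂(S.π i), b.1 = -b.2
  amplitude : ∀ i, ∀ᵐ b ∂(S.π i), ‖b.1‖ ≤ K * bMin (S.𝒟 i)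
  p_tendsto : Tendsto S.p atTop atTop
  k_small : (fun i => (S.k i : ℝ)) =o[atTop] fun i => Real.sqrt (S.p i)
  n_large : (fun i => max (S.k i : ℝ) (Real.log (S.p i))) =o[atTop] fun i => (S.n i : ℝ)
  n_small : (fun i => (S.n i : ℝ)) =o[atTop] fun i => S.nAlg i / Real.log (S.p i)

end Params

end MSLR

end

open MSLR

noncomputable section

set_option linter.unusedSectionVars false

namespace MSLR

/-! ### Hermite polynomials -/

/-! Divide the response by τ = √(r²/σ² + 1). Under the null law all data entries become independent
standard Gaussians, Hermite products are orthogonal, and Cauchy–Schwarz bounds the supremum over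
polynomials of degree at most D by the sum of the squared normalized Hermite coefficients of the
planted law (`chiSqLE_le_coeffEnergy`). Given signal and label, the normalized response of a row is
a unit linear form τ⁻¹w ± ⟨θ, x⟩ in standard Gaussians, with θ = β₁/(στ). Gaussian integration by
parts gives its correlation with a Hermite product of degrees (a, b): b! θ^a if |a| = b, and 0
otherwise (`IsStein.hermProd_mul_herm_linForm`). The average over the fair sign then removes all odd
b (`integral_row`).

Squaring the mean over the signal introduces an independent copy θ'. The multinomial theorem resums
each row into even powers of t = ⟨θ, θ'⟩, and the energy becomes the expectation of ∑ t^(2|d|) over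
d ∈ ℕⁿ with |d| ≤ D/4 (`coeffEnergy_eq`). At most (n+s)^s/s! vectors d have |d| = s, and |t| ≤ B²
z/(r² + σ²), where z counts the common support coordinates. In the allowed range of D the terms with
|d| = s together are at most z^(2s)/(2s)!, so the sum is at most exp z (`sum_exponents_le_exp`).
Given the first signal, z is hypergeometric, and its exponential moment is at most exp((e-1)k²/p) ≤
e ≤ 3 (`IsSignalLaw.integral_exp_overlap_le`).

For sequences, B = max(K, 1)·β_min together with k β_min² ≤ r² turns the admissible range into a
constant multiple of `rate`. The regime forces log p = o(`rate`), so if log n = O(log p), the degree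
⌊c·`rate`⌋ is ω(log N) and can be fed to the low-degree conjecture. -/

/-- The probabilists' Hermite polynomials with real coefficients. -/
def herm (n : ℕ) : Polynomial ℝ := (Polynomial.hermite n).map (Int.castRingHom ℝ)

lemma herm_zero : herm 0 = 1 := by simp [herm]

lemma herm_succ (n : ℕ) :
    herm (n + 1) = Polynomial.X * herm n - Polynomial.derivative (herm n) := by
  simp [herm, Polynomial.derivative_map]

/-- The Appell property, by induction from the raising recurrence. At n = 0 the factor 0 makes the
truncated index harmless. -/
lemma derivative_herm (n : ℕ) :
    Polynomial.derivative (herm n) = (n : ℝ) • herm (n - 1) := by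
  induction n with
  | zero => simp [herm_zero]
  | succ n ih =>
    rw [herm_succ, Polynomial.derivative_sub, Polynomial.derivative_mul, ih]
    cases n with
    | zero => simp [herm_zero]
    | succ m =>
      simp only [Nat.add_sub_cancel, Polynomial.derivative_X, one_mul,
        Polynomial.derivative_smul]
      rw [herm_succ m]
      simp only [Polynomial.smul_eq_C_mul]
      push_cast
      simp only [map_add, map_one]
      ring

section Multivariate

open MvPolynomial

variable {κ : Type*} [Fintype κ] [DecidableEq κ]

/-- The product of univariate Hermite polynomials in the different variables. -/
def hermProd (a : κ → ℕ) : MvPolynomial κ ℝ := ∏ s, Polynomial.aeval (X s) (herm (a s))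

lemma hermProd_zero : hermProd (0 : κ → ℕ) = 1 := by simp [hermProd, herm_zero]

lemma hermProd_eq_mul (a : κ → ℕ) (j : κ) :
    hermProd a = Polynomial.aeval (X j) (herm (a j)) *
      ∏ s ∈ Finset.univ.erase j, Polynomial.aeval (X s : MvPolynomial κ ℝ) (herm (a s)) :=
  (Finset.mul_prod_erase _ _ (Finset.mem_univ j)).symm

lemma hermProd_update (a : κ → ℕ) (j : κ) (m : ℕ) :
    hermProd (Function.update a j m) = Polynomial.aeval (X j) (herm m) *
      ∏ s ∈ Finset.univ.erase j, Polynomial.aeval (X s : MvPolynomial κ ℝ) (herm (a s)) := by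
  rw [hermProd_eq_mul _ j, Function.update_self]
  congr 1
  refine Finset.prod_congr rfl fun s hs => ?_
  rw [Function.update_of_ne (Finset.ne_of_mem_erase hs)]

lemma pderiv_hermProd (a : κ → ℕ) (j : κ) :
    pderiv j (hermProd a) = (a j : ℝ) • hermProd (Function.update a j (a j - 1)) := by
  rw [hermProd_update, hermProd_eq_mul a j, Derivation.leibniz, Derivation.map_aeval,
    derivative_herm]
  have h : pderiv j (∏ s ∈ Finset.univ.erase j,
      Polynomial.aeval (X s : MvPolynomial κ ℝ) (herm (a s))) = 0 := by
    refine Finset.prod_induction _ (fun q => pderiv j q = 0) ?_ (by simp) ?_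
    · intro f g hf hg
      simp [Derivation.leibniz, hf, hg]
    · intro s hs
      rw [Derivation.map_aeval, pderiv_X_of_ne (Finset.ne_of_mem_erase hs), smul_zero]
  rw [h]
  simp [mul_comm]

/-- The raising operator X_j - ∂_j, which integration by parts makes the adjoint of ∂_j. -/
lemma hermProd_update_succ (a : κ → ℕ) (j : κ) :
    hermProd (Function.update a j (a j + 1)) = X j * hermProd a - pderiv j (hermProd a) := by
  rw [pderiv_hermProd, hermProd_update, hermProd_update,
    hermProd_eq_mul a j, herm_succ, derivative_herm]
  simp only [map_sub, map_mul, Polynomial.aeval_X, map_smul, smul_mul_assoc, sub_mul]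
  ring

lemma X_mul_hermProd (a : κ → ℕ) (j : κ) :
    X j * hermProd a = hermProd (Function.update a j (a j + 1)) +
      (a j : ℝ) • hermProd (Function.update a j (a j - 1)) := by
  rw [hermProd_update_succ, pderiv_hermProd]; ring

lemma sum_update_succ (a : κ → ℕ) (j : κ) :
    ∑ s, Function.update a j (a j + 1) s = ∑ s, a s + 1 := by
  rw [Finset.sum_update_of_mem (Finset.mem_univ j), ← Finset.add_sum_erase _ _ (Finset.mem_univ j),
    Finset.sdiff_singleton_eq_erase]
  ring

lemma sum_update_pred_le (a : κ → ℕ) (j : κ) :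
    ∑ s, Function.update a j (a j - 1) s ≤ ∑ s, a s := by
  refine Finset.sum_le_sum fun s _ => ?_
  rcases eq_or_ne s j with rfl | h
  · simp
  · simp [h]

/-! ### Expansion in Hermite polynomials -/

variable (κ) in
/-- The exponents of total degree at most `D`. -/
def exponents (D : ℕ) : Finset (κ → ℕ) :=
  (Fintype.piFinset fun _ => Finset.range (D + 1)).filter fun a => ∑ s, a s ≤ D

lemma mem_exponents {D : ℕ} {a : κ → ℕ} : a ∈ exponents κ D ↔ ∑ s, a s ≤ D := by
  simp only [exponents, Finset.mem_filter, Fintype.mem_piFinset, Finset.mem_range,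
    and_iff_right_iff_imp]
  intro h s
  have := Finset.single_le_sum (f := a) (fun _ _ => Nat.zero_le _) (Finset.mem_univ s)
  omega

/-- The three-term recurrence `X_mul_hermProd` produces one Hermite product of degree one higher and
one of no higher degree. Iterating over the factors of a monomial gives the Hermite expansion with
control of the degree. -/
lemma X_mul_mem_span {D : ℕ} {f : MvPolynomial κ ℝ} (j : κ)
    (hf : f ∈ Submodule.span ℝ (hermProd '' (exponents κ D : Set (κ → ℕ)))) :
    X j * f ∈ Submodule.span ℝ (hermProd '' (exponents κ (D + 1) : Set (κ → ℕ))) := by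
  induction hf using Submodule.span_induction with
  | mem f hf =>
    obtain ⟨a, ha, rfl⟩ := hf
    rw [Finset.mem_coe, mem_exponents] at ha
    rw [X_mul_hermProd]
    refine Submodule.add_mem _ (Submodule.subset_span ⟨_, ?_, rfl⟩)
      (Submodule.smul_mem _ _ (Submodule.subset_span ⟨_, ?_, rfl⟩))
    · rw [Finset.mem_coe, mem_exponents, sum_update_succ]; omega
    · rw [Finset.mem_coe, mem_exponents]
      have := sum_update_pred_le a j
      omega
  | zero => simp
  | add f g _ _ hf hg => rw [mul_add]; exact Submodule.add_mem _ hf hg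
  | smul c f _ hf => rw [mul_smul_comm]; exact Submodule.smul_mem _ _ hf

lemma span_mono {D D' : ℕ} (h : D ≤ D') :
    Submodule.span ℝ (hermProd '' (exponents κ D : Set (κ → ℕ))) ≤
      Submodule.span ℝ (hermProd '' (exponents κ D' : Set (κ → ℕ))) := by
  refine Submodule.span_mono (Set.image_mono fun a ha => ?_)
  rw [Finset.mem_coe, mem_exponents] at ha ⊢
  omega

lemma aeval_monomial_mem_span {τ : Type*} (e : τ → κ) (t : τ → ℝ) (m : τ →₀ ℕ) :
    aeval (fun s => C (t s) * X (e s) : τ → MvPolynomial κ ℝ) (monomial m (1 : ℝ)) ∈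
      Submodule.span ℝ (hermProd '' (exponents κ m.degree : Set (κ → ℕ))) := by
  classical
  induction hd : m.degree generalizing m with
  | zero =>
    obtain rfl : m = 0 := (Finsupp.degree_eq_zero_iff m).1 hd
    refine Submodule.subset_span ⟨0, ?_, ?_⟩
    · simp [mem_exponents]
    · rw [hermProd_zero, ← C_apply, map_one, map_one]
  | succ d ih =>
    obtain ⟨s, hs⟩ : ∃ s, m s ≠ 0 := by
      by_contra! h
      obtain rfl : m = 0 := Finsupp.ext h
      simp at hd
    obtain ⟨m', rfl⟩ : ∃ m', m = m' + Finsupp.single s 1 :=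
      ⟨m - Finsupp.single s 1, (tsub_add_cancel_of_le (by
        rw [Finsupp.single_le_iff]; omega)).symm⟩
    rw [map_add, Finsupp.degree_single, Nat.add_right_cancel_iff] at hd
    have h1 : monomial (m' + Finsupp.single s 1) (1 : ℝ) = X s * monomial m' 1 := by
      rw [X, monomial_mul, one_mul, add_comm]
    rw [h1, map_mul, aeval_X, mul_assoc, ← MvPolynomial.smul_eq_C_mul]
    exact Submodule.smul_mem _ _ (X_mul_mem_span _ (ih m' hd))

/-- Every polynomial of degree at most `D`, after a rescaling and relabelling of its variables, is
a combination of Hermite products of degree at most `D`. -/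
lemma exists_hermite_expansion {τ : Type*} (e : τ → κ) (t : τ → ℝ) {D : ℕ}
    (f : MvPolynomial τ ℝ) (hf : f.totalDegree ≤ D) :
    ∃ c : (κ → ℕ) → ℝ, aeval (fun s => C (t s) * X (e s) : τ → MvPolynomial κ ℝ) f =
      ∑ a ∈ exponents κ D, c a • hermProd a := by
  suffices h : aeval (fun s => C (t s) * X (e s) : τ → MvPolynomial κ ℝ) f ∈
      Submodule.span ℝ (hermProd '' (exponents κ D : Set (κ → ℕ))) by
    obtain ⟨c, hc⟩ := (Submodule.mem_span_image_finset_iff_exists_fun' ℝ).1 h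
    exact ⟨c, hc.symm⟩
  rw [f.as_sum, map_sum]
  refine Submodule.sum_mem _ fun m hm => ?_
  have h1 : monomial m (coeff m f) = coeff m f • monomial m (1 : ℝ) := by
    rw [smul_monomial, smul_eq_mul, mul_one]
  rw [h1, map_smul]
  refine Submodule.smul_mem _ _ (span_mono ?_ (aeval_monomial_mem_span e t m))
  exact (le_totalDegree hm).trans hf

/-! ### Gaussian integration by parts, algebraically -/

/-- A normalized linear functional on polynomials that satisfies Gaussian integration by parts. -/
structure IsStein (E : MvPolynomial κ ℝ →ₗ[ℝ] ℝ) : Prop where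
  one : E 1 = 1
  parts : ∀ j f, E (X j * f) = E (pderiv j f)

/-- The linear form with the given coefficients. -/
def linForm (c : κ → ℝ) : MvPolynomial κ ℝ := ∑ s, C (c s) * X s

lemma pderiv_linForm (c : κ → ℝ) (j : κ) : pderiv j (linForm c) = C (c j) := by
  rw [linForm, map_sum, Finset.sum_eq_single j]
  · simp
  · intro s _ hs
    simp [pderiv_X_of_ne hs]
  · simp

lemma pderiv_herm_linForm (c : κ → ℝ) (j : κ) (b : ℕ) :
    pderiv j (Polynomial.aeval (linForm c) (herm b)) =
      (c j * b) • Polynomial.aeval (linForm c) (herm (b - 1)) := by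
  rw [Derivation.map_aeval, pderiv_linForm, derivative_herm, map_smul, smul_eq_mul,
    MvPolynomial.smul_eq_C_mul, MvPolynomial.smul_eq_C_mul, map_mul]
  ring

namespace IsStein

variable {E : MvPolynomial κ ℝ →ₗ[ℝ] ℝ}

/-- Adjointness: integration by parts turns X_j h f into ∂_j(h f), and the term (∂_j h) f cancels.
-/
lemma hermProd_update_succ_mul (hE : IsStein E) (a : κ → ℕ) (j : κ) (f : MvPolynomial κ ℝ) :
    E (hermProd (Function.update a j (a j + 1)) * f) = E (hermProd a * pderiv j f) := by
  rw [hermProd_update_succ, sub_mul, map_sub, mul_assoc, hE.parts, Derivation.leibniz, map_add]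
  simp [mul_comm]

/-- A unit linear form L inherits one-dimensional integration by parts: the factors c_s² sum to 1,
so L·H_b(L) and H_b'(L) have the same mean, and their difference is H_(b+1)(L). -/
lemma herm_linForm (hE : IsStein E) {c : κ → ℝ} (hc : ∑ s, c s ^ 2 = 1) (b : ℕ) :
    E (Polynomial.aeval (linForm c) (herm b)) = if b = 0 then 1 else 0 := by
  cases b with
  | zero => simp [herm_zero, hE.one]
  | succ b =>
    have h1 : E (linForm c * Polynomial.aeval (linForm c) (herm b)) =
        b * E (Polynomial.aeval (linForm c) (herm (b - 1))) := by
      conv_lhs => rw [linForm, Finset.sum_mul, map_sum]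
      have : ∀ s, E (C (c s) * X s * Polynomial.aeval (linForm c) (herm b)) =
          c s ^ 2 * (b * E (Polynomial.aeval (linForm c) (herm (b - 1)))) := by
        intro s
        rw [mul_assoc, ← MvPolynomial.smul_eq_C_mul, map_smul, hE.parts, pderiv_herm_linForm,
          map_smul, smul_eq_mul, smul_eq_mul]
        ring
      have h2 : ∑ s, E (C (c s) * X s * Polynomial.aeval (linForm c) (herm b)) =
          b * E (Polynomial.aeval (linForm c) (herm (b - 1))) := by
        rw [Finset.sum_congr rfl fun s _ => this s, ← Finset.sum_mul, hc, one_mul]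
      exact h2
    rw [herm_succ, derivative_herm, map_sub, map_mul, Polynomial.aeval_X, map_sub, h1, map_smul,
      map_smul, smul_eq_mul, sub_self, if_neg (Nat.succ_ne_zero b)]

/-- The correlation of a Hermite product with a Hermite polynomial of a unit linear form. -/
theorem hermProd_mul_herm_linForm (hE : IsStein E) {c : κ → ℝ} (hc : ∑ s, c s ^ 2 = 1)
    (a : κ → ℕ) (b : ℕ) :
    E (hermProd a * Polynomial.aeval (linForm c) (herm b)) =
      if ∑ s, a s = b then (b.factorial : ℝ) * ∏ s, c s ^ a s else 0 := by
  induction hN : ∑ s, a s generalizing a b with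
  | zero =>
    have ha : a = 0 := by
      funext s
      exact (Finset.sum_eq_zero_iff.1 hN) s (Finset.mem_univ s)
    subst ha
    rw [hermProd_zero, one_mul, hE.herm_linForm hc]
    rcases eq_or_ne b 0 with rfl | hb
    · simp
    · simp [hb, hb.symm]
  | succ N ih =>
    obtain ⟨j, hj⟩ : ∃ j, a j ≠ 0 := by
      by_contra! h
      simp [h] at hN
    obtain ⟨a', rfl⟩ : ∃ a', a = Function.update a' j (a' j + 1) := by
      refine ⟨Function.update a j (a j - 1), ?_⟩
      simp [Nat.sub_add_cancel (Nat.pos_of_ne_zero hj)]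
    rw [sum_update_succ, Nat.add_right_cancel_iff] at hN
    -- Moving one raising operator across lowers b by one and releases a factor c_j b; the induction
    -- is on the total degree of a.
    rw [hE.hermProd_update_succ_mul, pderiv_herm_linForm, mul_smul_comm, map_smul, ih a' _ hN]
    have hp : ∏ s, c s ^ Function.update a' j (a' j + 1) s = c j * ∏ s, c s ^ a' s := by
      rw [← Finset.mul_prod_erase _ _ (Finset.mem_univ j),
        ← Finset.mul_prod_erase _ (fun s => c s ^ a' s) (Finset.mem_univ j),
        Function.update_self, pow_succ', mul_assoc]
      congr 2
      refine Finset.prod_congr rfl fun s hs => ?_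
      rw [Function.update_of_ne (Finset.ne_of_mem_erase hs)]
    rw [hp]
    cases b with
    | zero => simp
    | succ b =>
      simp only [Nat.add_sub_cancel, Nat.add_right_cancel_iff, smul_eq_mul]
      split_ifs
      · rw [Nat.factorial_succ]; push_cast; ring
      · ring

end IsStein

end Multivariate

/-! ### Random variables with moments of all orders -/

section Moments

variable {Ω Ω' : Type*} [MeasurableSpace Ω] [MeasurableSpace Ω'] {μ : Measure Ω} {ν : Measure Ω'}

/-- A random variable with moments of all orders. -/
def HasMoments (f : Ω → ℝ) (μ : Measure Ω) : Prop := ∀ q : ℕ, MemLp f q μ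

namespace HasMoments

variable {f g : Ω → ℝ}

lemma integrable (hf : HasMoments f μ) : Integrable f μ := by
  have := hf 1
  rwa [Nat.cast_one, memLp_one_iff_integrable] at this

lemma add (hf : HasMoments f μ) (hg : HasMoments g μ) : HasMoments (fun x => f x + g x) μ :=
  fun q => (hf q).add (hg q)

lemma mul (hf : HasMoments f μ) (hg : HasMoments g μ) : HasMoments (fun x => f x * g x) μ := by
  intro q
  -- Cauchy–Schwarz: the product of two functions in L^(2q) is in L^q.
  have : ENNReal.HolderTriple ((2 * q : ℕ) : ℝ≥0∞) ((2 * q : ℕ) : ℝ≥0∞) q := by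
    constructor
    push_cast
    rw [ENNReal.mul_inv (by simp) (by simp), ← add_mul, ENNReal.inv_two_add_inv_two, one_mul]
  exact (hg (2 * q)).mul' (hf (2 * q))

lemma const [IsFiniteMeasure μ] (c : ℝ) : HasMoments (fun _ => c) μ := fun _ => memLp_const c

lemma const_mul [IsFiniteMeasure μ] (c : ℝ) (hf : HasMoments f μ) :
    HasMoments (fun x => c * f x) μ := (const c).mul hf

lemma sum {ι : Type*} [IsFiniteMeasure μ] (s : Finset ι) {F : ι → Ω → ℝ}
    (hF : ∀ i ∈ s, HasMoments (F i) μ) : HasMoments (fun x => ∑ i ∈ s, F i x) μ :=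
  fun q => memLp_finsetSum s fun i hi => hF i hi q

lemma of_bound [IsFiniteMeasure μ] (hf : AEStronglyMeasurable f μ) (C : ℝ)
    (h : ∀ᵐ x ∂μ, |f x| ≤ C) : HasMoments f μ :=
  fun _ => MemLp.of_bound hf C (by simpa using h)

lemma comp {h : Ω' → Ω} (hf : HasMoments f μ) (hh : MeasurePreserving h ν μ) :
    HasMoments (fun x => f (h x)) ν :=
  fun q => (hf q).comp_measurePreserving hh

lemma eval [IsFiniteMeasure μ] {κ : Type*} {G : κ → Ω → ℝ} (hG : ∀ s, HasMoments (G s) μ)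
    (p : MvPolynomial κ ℝ) : HasMoments (fun x => MvPolynomial.eval (fun s => G s x) p) μ := by
  induction p using MvPolynomial.induction_on with
  | C a => simpa using const a
  | add p q hp hq => simpa using hp.add hq
  | mul_X p s hp => simpa using hp.mul (hG s)

end HasMoments

lemma hasMoments_gaussianReal : HasMoments (fun x : ℝ => x) (gaussianReal 0 1) := fun q => by
  have := memLp_id_gaussianReal (μ := 0) (v := 1) (q : ℝ≥0)
  exact_mod_cast this

/-- The expectation of a polynomial in random variables with moments of all orders. -/
def expectation [IsFiniteMeasure μ] {κ : Type*} {G : κ → Ω → ℝ} (hG : ∀ s, HasMoments (G s) μ) :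
    MvPolynomial κ ℝ →ₗ[ℝ] ℝ where
  toFun p := ∫ x, MvPolynomial.eval (fun s => G s x) p ∂μ
  map_add' p q := by
    simp only [map_add]
    exact integral_add (HasMoments.eval hG p).integrable (HasMoments.eval hG q).integrable
  map_smul' c p := by
    simp only [MvPolynomial.smul_eval, RingHom.id_apply, smul_eq_mul]
    exact integral_const_mul _ _

lemma expectation_apply [IsFiniteMeasure μ] {κ : Type*} {G : κ → Ω → ℝ}
    (hG : ∀ s, HasMoments (G s) μ) (p : MvPolynomial κ ℝ) :
    expectation hG p = ∫ x, MvPolynomial.eval (fun s => G s x) p ∂μ := rfl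

end Moments

/-! ### Gaussian moments -/

/-- The moments of the standard Gaussian law. -/
def gaussMoment (m : ℕ) : ℝ := ∫ x, x ^ m ∂gaussianReal 0 1

lemma gaussMoment_zero : gaussMoment 0 = 1 := by simp [gaussMoment]

lemma hasDerivAt_gaussianPDFReal (x : ℝ) :
    HasDerivAt (gaussianPDFReal 0 1) (-(x * gaussianPDFReal 0 1 x)) x := by
  have h : HasDerivAt (fun y : ℝ => -(y - 0) ^ 2 / (2 * (1 : ℝ≥0))) (-x) x := by
    have := (((hasDerivAt_id x).sub_const 0).pow 2).neg.div_const (2 * ((1 : ℝ≥0) : ℝ))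
    refine this.congr_deriv ?_
    simp
    ring
  refine (h.exp.const_mul _).congr_deriv ?_
  simp only [gaussianPDFReal]
  ring

lemma integrable_pow_mul_gaussianPDFReal (m : ℕ) :
    Integrable fun x : ℝ => x ^ m * gaussianPDFReal 0 1 x := by
  have h : Integrable (fun x : ℝ => x ^ m) (gaussianReal 0 1) := by
    have := HasMoments.eval (κ := Unit) (fun _ => hasMoments_gaussianReal) (MvPolynomial.X () ^ m)
    simpa using this.integrable
  rw [gaussianReal_of_var_ne_zero 0 one_ne_zero, integrable_withDensity_iff_integrable_smul'
    (measurable_gaussianPDF 0 1) (ae_of_all _ fun _ => gaussianPDF_lt_top)] at h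
  simpa [toReal_gaussianPDF, mul_comm] using h

/-- Integration by parts of x^m against the density φ, using φ' = -xφ. For m = 0 the right side is
0. -/
lemma gaussMoment_succ (m : ℕ) : gaussMoment (m + 1) = m * gaussMoment (m - 1) := by
  simp only [gaussMoment, integral_gaussianReal_eq_integral_smul one_ne_zero, smul_eq_mul]
  have h := integral_mul_deriv_eq_deriv_mul_of_integrable (u := fun x : ℝ => x ^ m)
    (u' := fun x => m * x ^ (m - 1)) (v := gaussianPDFReal 0 1)
    (v' := fun x => -(x * gaussianPDFReal 0 1 x)) (fun x _ => hasDerivAt_pow m x)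
    (fun x _ => hasDerivAt_gaussianPDFReal x) ?_ ?_ (integrable_pow_mul_gaussianPDFReal m)
  · simp only [mul_neg, integral_neg, neg_inj] at h
    rw [← integral_const_mul]
    refine Eq.trans (integral_congr_ae (ae_of_all _ fun x => ?_))
      (h.trans (integral_congr_ae (ae_of_all _ fun x => ?_)))
    · simp only [pow_succ]; ring
    · simp only; ring
  · convert (integrable_pow_mul_gaussianPDFReal (m + 1)).neg using 1
    funext x
    simp only [Pi.mul_apply, Pi.neg_apply]
    ring
  · convert (integrable_pow_mul_gaussianPDFReal (m - 1)).const_mul (m : ℝ) using 1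
    funext x
    simp only [Pi.mul_apply]
    ring

open MvPolynomial in
/-- A linear functional with the moments of independent standard Gaussians satisfies Gaussian
integration by parts. -/
lemma isStein_of_moments {κ : Type*} [Fintype κ] [DecidableEq κ] {E : MvPolynomial κ ℝ →ₗ[ℝ] ℝ}
    (hE : ∀ m : κ →₀ ℕ, E (monomial m 1) = ∏ s, gaussMoment (m s)) : IsStein E where
  one := by
    have := hE 0
    simpa [gaussMoment_zero] using this
  parts j f := by
    have key : ∀ m : κ →₀ ℕ, E (X j * monomial m 1) = E (pderiv j (monomial m 1)) := by
      intro m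
      have h1 : X j * monomial m (1 : ℝ) = monomial (m + Finsupp.single j 1) 1 := by
        rw [X, monomial_mul, one_mul, add_comm]
      have h2 : monomial (m - Finsupp.single j 1) (1 * (m j : ℝ)) =
          (m j : ℝ) • monomial (m - Finsupp.single j 1) (1 : ℝ) := by
        rw [smul_monomial, smul_eq_mul, one_mul, mul_one]
      rw [h1, pderiv_monomial, h2, map_smul, hE, hE, smul_eq_mul,
        ← Finset.mul_prod_erase _ _ (Finset.mem_univ j),
        ← Finset.mul_prod_erase _ (fun s => gaussMoment ((m - Finsupp.single j 1 : κ →₀ ℕ) s))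
          (Finset.mem_univ j), ← mul_assoc]
      congr 1
      · simp [gaussMoment_succ]
      · refine Finset.prod_congr rfl fun s hs => ?_
        simp [Finsupp.single_eq_of_ne (Finset.ne_of_mem_erase hs)]
    rw [f.as_sum, Finset.mul_sum, map_sum, map_sum, map_sum]
    refine Finset.sum_congr rfl fun m _ => ?_
    have h1 : monomial m (coeff m f) = coeff m f • monomial m (1 : ℝ) := by
      rw [smul_monomial, smul_eq_mul, mul_one]
    rw [h1, mul_smul_comm, map_smul, Derivation.map_smul, map_smul, key]

/-! ### Gaussian expectations of Hermite polynomials -/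

lemma eval_hermProd {κ : Type*} [Fintype κ] [DecidableEq κ] (a : κ → ℕ) (x : κ → ℝ) :
    MvPolynomial.eval x (hermProd a) = ∏ s, (herm (a s)).eval (x s) := by
  rw [hermProd, map_prod]
  refine Finset.prod_congr rfl fun s _ => ?_
  rw [← MvPolynomial.coe_aeval_eq_eval, RingHom.coe_coe, ← Polynomial.aeval_algHom_apply]
  simp [Polynomial.aeval_def, Polynomial.eval₂_eq_eval_map]

lemma eval_herm_linForm {κ : Type*} [Fintype κ] (c : κ → ℝ) (b : ℕ) (x : κ → ℝ) :
    MvPolynomial.eval x (Polynomial.aeval (linForm c) (herm b)) =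
      (herm b).eval (∑ s, c s * x s) := by
  rw [← MvPolynomial.coe_aeval_eq_eval, RingHom.coe_coe, ← Polynomial.aeval_algHom_apply]
  simp [Polynomial.aeval_def, Polynomial.eval₂_eq_eval_map, linForm]

/-- Orthogonality of the Hermite polynomials. -/
lemma integral_herm_mul_herm (a b : ℕ) :
    ∫ x, (herm a).eval x * (herm b).eval x ∂gaussianReal 0 1 =
      if a = b then (b.factorial : ℝ) else 0 := by
  have hS : IsStein (expectation (κ := Unit) fun _ => hasMoments_gaussianReal) := by
    refine isStein_of_moments fun m => ?_
    simp [expectation_apply, gaussMoment, MvPolynomial.eval_monomial]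
  -- In one variable, x itself is a unit linear form.
  have := hS.hermProd_mul_herm_linForm (c := fun _ => 1) (by simp) (fun _ => a) b
  simpa [expectation_apply, eval_hermProd, eval_herm_linForm] using this

/-- The correlation of a Hermite product in `x` with a Hermite polynomial of the unit linear form
`⟨θ, x⟩ + c₀ w` of independent standard Gaussians. -/
lemma integral_hermProd_mul_herm {p : ℕ} {θ : Fin p → ℝ} {c₀ : ℝ}
    (hc : c₀ ^ 2 + ∑ j, θ j ^ 2 = 1) (a : Fin p → ℕ) (b : ℕ) :
    ∫ t, (∏ j, (herm (a j)).eval (t.1 j)) * (herm b).eval (c₀ * t.2 + ∑ j, θ j * t.1 j)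
      ∂(Measure.pi fun _ : Fin p => gaussianReal 0 1).prod (gaussianReal 0 1) =
      if ∑ j, a j = b then (b.factorial : ℝ) * ∏ j, θ j ^ a j else 0 := by
  let G : Option (Fin p) → (Fin p → ℝ) × ℝ → ℝ := fun s t => s.elim t.2 t.1
  have hG : ∀ s, HasMoments (G s)
      ((Measure.pi fun _ : Fin p => gaussianReal 0 1).prod (gaussianReal 0 1)) := by
    rintro (_ | j)
    · exact hasMoments_gaussianReal.comp measurePreserving_snd
    · exact (hasMoments_gaussianReal.comp (measurePreserving_eval (fun _ : Fin p => gaussianReal 0 1)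
        j)).comp measurePreserving_fst
  have hS : IsStein (expectation hG) := by
    refine isStein_of_moments fun m => ?_
    simp only [expectation_apply, MvPolynomial.eval_monomial, one_mul, Finsupp.prod_pow,
      Fintype.prod_option, G, Option.elim]
    simp_rw [mul_comm (_ ^ _ : ℝ)]
    rw [integral_prod_mul (fun x : Fin p → ℝ => ∏ j, x j ^ m (some j)) (fun w : ℝ => w ^ m none),
      integral_fintype_prod_eq_prod (fun j (y : ℝ) => y ^ m (some j)), mul_comm]
    rfl
  -- The noise is the extra variable `none`. It enters the linear form with coefficient c₀ and the
  -- Hermite product with exponent 0.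
  have := hS.hermProd_mul_herm_linForm (c := fun s => s.elim c₀ θ)
    (by simpa [Fintype.sum_option] using hc) (fun s => s.elim 0 a) b
  simpa [expectation_apply, eval_hermProd, eval_herm_linForm, Fintype.prod_option,
    Fintype.sum_option, herm_zero, G] using this

namespace HasMoments

variable {Ω : Type*} [MeasurableSpace Ω] {μ : Measure Ω} [IsFiniteMeasure μ]

lemma prod {ι : Type*} (s : Finset ι) {F : ι → Ω → ℝ}
    (hF : ∀ i ∈ s, HasMoments (F i) μ) : HasMoments (fun x => ∏ i ∈ s, F i x) μ := by
  classical
  induction s using Finset.induction_on with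
  | empty => simpa using const 1
  | insert i s hi ih =>
    simp only [Finset.prod_insert hi]
    exact (hF i (Finset.mem_insert_self i s)).mul
      (ih fun j hj => hF j (Finset.mem_insert_of_mem hj))

lemma polynomial_eval {f : Ω → ℝ} (hf : HasMoments f μ) (q : Polynomial ℝ) :
    HasMoments (fun x => q.eval (f x)) μ := by
  induction q using Polynomial.induction_on with
  | C a => simpa using const a
  | add p q hp hq => simpa using hp.add hq
  | monomial m a h =>
    simp only [pow_succ, ← mul_assoc]
    simpa [mul_assoc] using h.mul hf

end HasMoments

/-! ### The law of one row of the data -/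

/-- The law of one label. -/
def labelLawOne : Measure ℝ :=
  ENNReal.ofReal (1 / 2) • Measure.dirac (1 : ℝ) +
    ENNReal.ofReal (1 - 1 / 2) • Measure.dirac (0 : ℝ)

instance : IsProbabilityMeasure labelLawOne := by
  constructor
  simp only [labelLawOne, Measure.add_apply, Measure.smul_apply, measure_univ, smul_eq_mul, mul_one]
  rw [← ENNReal.ofReal_add (by norm_num) (by norm_num)]
  norm_num

lemma integral_labelLawOne (f : ℝ → ℝ) : ∫ z, f z ∂labelLawOne = (f 1 + f 0) / 2 := by
  rw [labelLawOne, integral_add_measure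
    ((integrable_dirac (by simp)).smul_measure (by simp))
    ((integrable_dirac (by simp)).smul_measure (by simp)),
    integral_smul_measure, integral_smul_measure, integral_dirac, integral_dirac,
    ENNReal.toReal_ofReal (by norm_num), ENNReal.toReal_ofReal (by norm_num)]
  simp only [smul_eq_mul]
  ring

lemma hasMoments_labelLawOne : HasMoments (fun z : ℝ => z) labelLawOne := by
  refine HasMoments.of_bound aestronglyMeasurable_id 1 ?_
  rw [labelLawOne, ae_add_measure_iff]
  constructor
  · exact Measure.ae_smul_measure (by simp [ae_dirac_eq]) _
  · exact Measure.ae_smul_measure (by simp [ae_dirac_eq]) _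

instance (n : ℕ) : IsProbabilityMeasure (noiseLaw n) := by unfold noiseLaw; infer_instance

instance (n p : ℕ) : IsProbabilityMeasure (designLaw n p) := by unfold designLaw; infer_instance

lemma labelLaw_half (n : ℕ) : labelLaw n (1 / 2) = Measure.pi fun _ => labelLawOne := rfl

instance (n : ℕ) : IsProbabilityMeasure (labelLaw n (1 / 2)) := by
  rw [labelLaw_half]; infer_instance

/-! ### Fubini and factorization over the rows -/

section LeftComm

variable {α β γ : Type*} [MeasurableSpace α] [MeasurableSpace β] [MeasurableSpace γ]

/-- Exchange of the first two factors of a triple product. -/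
def prodLeftComm : α × β × γ ≃ᵐ β × α × γ :=
  MeasurableEquiv.prodAssoc.symm.trans
    ((MeasurableEquiv.prodComm.prodCongr (MeasurableEquiv.refl γ)).trans MeasurableEquiv.prodAssoc)

lemma measurePreserving_prodLeftComm (μ : Measure α) (ν : Measure β) (ρ : Measure γ)
    [SFinite μ] [SFinite ν] [SFinite ρ] :
    MeasurePreserving (prodLeftComm (α := α) (β := β) (γ := γ))
      (μ.prod (ν.prod ρ)) (ν.prod (μ.prod ρ)) := by
  have h1 := (measurePreserving_prodAssoc μ ν ρ).symm MeasurableEquiv.prodAssoc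
  have h2 : MeasurePreserving (Prod.map Prod.swap id) ((μ.prod ν).prod ρ) ((ν.prod μ).prod ρ) :=
    Measure.measurePreserving_swap.prod (MeasurePreserving.id ρ)
  exact ((measurePreserving_prodAssoc ν μ ρ).comp h2).comp h1

/-- Integrates the middle variable last: the label within one row, and the signal pair in the whole
sample. -/
lemma integral_prodLeftComm {μ : Measure α} {ν : Measure β} {ρ : Measure γ}
    [SFinite μ] [SFinite ν] [SFinite ρ] {f : β → α → γ → ℝ}
    (hf : Integrable (fun t : α × β × γ => f t.2.1 t.1 t.2.2) (μ.prod (ν.prod ρ))) :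
    ∫ t, f t.2.1 t.1 t.2.2 ∂μ.prod (ν.prod ρ) = ∫ b, ∫ t, f b t.1 t.2 ∂μ.prod ρ ∂ν := by
  have hp := measurePreserving_prodLeftComm μ ν ρ
  have h1 := hp.integral_comp' (fun u : β × α × γ => f u.1 u.2.1 u.2.2)
  have h2 : Integrable (fun u : β × α × γ => f u.1 u.2.1 u.2.2) (ν.prod (μ.prod ρ)) :=
    (hp.integrable_comp_emb prodLeftComm.measurableEmbedding).1 hf
  exact h1.trans (integral_prod _ h2)

end LeftComm

/-- Regrouping the two families by index makes the rows independent pairs, so the integral factors.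
-/
lemma integral_pi_prod_pi {ι α β : Type*} [Fintype ι] [MeasurableSpace α] [MeasurableSpace β]
    (μ : Measure α) (ν : Measure β) [SigmaFinite μ] [SigmaFinite ν] (f : ι → α → β → ℝ) :
    ∫ t, ∏ i, f i (t.1 i) (t.2 i) ∂(Measure.pi fun _ : ι => μ).prod (Measure.pi fun _ => ν) =
      ∏ i, ∫ t, f i t.1 t.2 ∂μ.prod ν := by
  rw [← (measurePreserving_arrowProdEquivProdArrow α β ι (fun _ => μ) fun _ => ν).integral_comp',
    ← integral_fintype_prod_eq_prod (fun i (t : α × β) => f i t.1 t.2)]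
  rfl

lemma integral_pi_prod_pi_prod_pi {ι α β γ : Type*} [Fintype ι] [MeasurableSpace α]
    [MeasurableSpace β] [MeasurableSpace γ] (μ : Measure α) (ν : Measure β) (ρ : Measure γ)
    [SigmaFinite μ] [SigmaFinite ν] [SigmaFinite ρ] (f : ι → α → β → γ → ℝ) :
    ∫ t, ∏ i, f i (t.1 i) (t.2.1 i) (t.2.2 i)
      ∂(Measure.pi fun _ : ι => μ).prod ((Measure.pi fun _ => ν).prod (Measure.pi fun _ => ρ)) =
      ∏ i, ∫ t, f i t.1 t.2.1 t.2.2 ∂μ.prod (ν.prod ρ) := by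
  have hp : MeasurePreserving ((MeasurableEquiv.refl (ι → α)).prodCongr
      (MeasurableEquiv.arrowProdEquivProdArrow β γ ι))
      ((Measure.pi fun _ : ι => μ).prod (Measure.pi fun _ : ι => ν.prod ρ))
      ((Measure.pi fun _ : ι => μ).prod ((Measure.pi fun _ => ν).prod (Measure.pi fun _ => ρ))) :=
    (MeasurePreserving.id _).prod
      (measurePreserving_arrowProdEquivProdArrow β γ ι (fun _ => ν) fun _ => ρ)
  rw [← hp.integral_comp', ← integral_pi_prod_pi μ (ν.prod ρ) fun i x t => f i x t.1 t.2]
  rfl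

/-- The expectation of a Hermite product in one row of the planted data, in terms of the normalized
signal. -/
def rowCoeff {p : ℕ} (θ : Fin p → ℝ) (a : Fin p → ℕ) (b : ℕ) : ℝ :=
  if ∑ j, a j = b ∧ Even b then (b.factorial : ℝ) * ∏ j, θ j ^ a j else 0

/-- The labels 1 and 0 give the linear forms τ⁻¹w + ⟨θ, x⟩ and τ⁻¹w - ⟨θ, x⟩, both of unit length by
the choice of τ. The two correlations differ by (-1)^b, so their average keeps even b and removes
odd b. -/
lemma integral_row {p : ℕ} {σ r τ : ℝ} (hσ : 0 < σ) (hτ : 0 < τ) (hτ2 : τ ^ 2 = r ^ 2 / σ ^ 2 + 1)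
    {v : Fin p → ℝ} (hv : ∑ j, v j ^ 2 = r ^ 2) (a : Fin p → ℕ) (b : ℕ) :
    ∫ t, (∏ j, (herm (a j)).eval (t.1 j)) * (herm b).eval (τ⁻¹ *
      (σ⁻¹ * (∑ j, t.1 j * v j) * t.2.1 + σ⁻¹ * (∑ j, t.1 j * (-v) j) * (1 - t.2.1) + t.2.2))
      ∂(Measure.pi fun _ : Fin p => gaussianReal 0 1).prod (labelLawOne.prod (gaussianReal 0 1)) =
      rowCoeff (fun j => v j / (σ * τ)) a b := by
  set μ := Measure.pi fun _ : Fin p => gaussianReal 0 1 with hμ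
  have hx : ∀ j, HasMoments (fun t : (Fin p → ℝ) × ℝ × ℝ => t.1 j)
      (μ.prod (labelLawOne.prod (gaussianReal 0 1))) := fun j =>
    (hasMoments_gaussianReal.comp (measurePreserving_eval (fun _ : Fin p => gaussianReal 0 1)
        j)).comp measurePreserving_fst
  have hz : HasMoments (fun t : (Fin p → ℝ) × ℝ × ℝ => t.2.1)
      (μ.prod (labelLawOne.prod (gaussianReal 0 1))) :=
    hasMoments_labelLawOne.comp (measurePreserving_fst.comp measurePreserving_snd)
  have hw : HasMoments (fun t : (Fin p → ℝ) × ℝ × ℝ => t.2.2)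
      (μ.prod (labelLawOne.prod (gaussianReal 0 1))) :=
    hasMoments_gaussianReal.comp (measurePreserving_snd.comp measurePreserving_snd)
  have hlin : ∀ u : Fin p → ℝ, HasMoments (fun t : (Fin p → ℝ) × ℝ × ℝ => σ⁻¹ * ∑ j, t.1 j * u j)
      (μ.prod (labelLawOne.prod (gaussianReal 0 1))) := fun u =>
    (HasMoments.sum _ fun j _ => (hx j).mul (HasMoments.const (u j))).const_mul _
  have hint := ((HasMoments.prod Finset.univ fun j _ => (hx j).polynomial_eval (herm (a j))).mul
    ((((((hlin v).mul hz).add ((hlin (-v)).mul ((HasMoments.const 1).add (hz.const_mul (-1))))).add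
      hw).const_mul τ⁻¹).polynomial_eval (herm b))).integrable
  have hint' : Integrable (fun t : (Fin p → ℝ) × ℝ × ℝ =>
      (∏ j, (herm (a j)).eval (t.1 j)) * (herm b).eval (τ⁻¹ *
      (σ⁻¹ * (∑ j, t.1 j * v j) * t.2.1 + σ⁻¹ * (∑ j, t.1 j * (-v) j) * (1 - t.2.1) + t.2.2)))
      (μ.prod (labelLawOne.prod (gaussianReal 0 1))) := by
    convert hint using 7
    ring
  refine (integral_prodLeftComm (f := fun (z : ℝ) (x : Fin p → ℝ) (w : ℝ) =>
    (∏ j, (herm (a j)).eval (x j)) * (herm b).eval (τ⁻¹ *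
      (σ⁻¹ * (∑ j, x j * v j) * z + σ⁻¹ * (∑ j, x j * (-v) j) * (1 - z) + w))) hint').trans ?_
  rw [integral_labelLawOne]
  have hc : ∀ s : ℝ, s ^ 2 = 1 → (τ⁻¹) ^ 2 + ∑ j, (s * (v j / (σ * τ))) ^ 2 = 1 := by
    intro s hs
    have : ∀ j, (s * (v j / (σ * τ))) ^ 2 = v j ^ 2 / (σ * τ) ^ 2 := fun j => by
      rw [mul_pow, hs, one_mul, div_pow]
    simp only [this]
    rw [← Finset.sum_div, hv, mul_pow, hτ2, inv_pow, hτ2]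
    have : r ^ 2 / σ ^ 2 + 1 ≠ 0 := by positivity
    field_simp
    ring
  have h1 := integral_hermProd_mul_herm (hc 1 (by norm_num)) a b
  have h0 := integral_hermProd_mul_herm (hc (-1) (by norm_num)) a b
  have e1 : ∀ t : (Fin p → ℝ) × ℝ, τ⁻¹ * (σ⁻¹ * (∑ j, t.1 j * v j) * 1 +
      σ⁻¹ * (∑ j, t.1 j * (-v) j) * (1 - 1) + t.2) =
      τ⁻¹ * t.2 + ∑ j, 1 * (v j / (σ * τ)) * t.1 j := by
    intro t
    have : ∀ j, 1 * (v j / (σ * τ)) * t.1 j = τ⁻¹ * σ⁻¹ * (t.1 j * v j) := fun j => by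
      field_simp
    simp only [this, ← Finset.mul_sum]
    ring
  have e0 : ∀ t : (Fin p → ℝ) × ℝ, τ⁻¹ * (σ⁻¹ * (∑ j, t.1 j * v j) * 0 +
      σ⁻¹ * (∑ j, t.1 j * (-v) j) * (1 - 0) + t.2) =
      τ⁻¹ * t.2 + ∑ j, -1 * (v j / (σ * τ)) * t.1 j := by
    intro t
    have : ∀ j, -1 * (v j / (σ * τ)) * t.1 j = τ⁻¹ * σ⁻¹ * (t.1 j * (-v) j) := fun j => by
      simp only [Pi.neg_apply]; field_simp
    simp only [this, ← Finset.mul_sum]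
    ring
  simp only [e1, e0]
  rw [h1, h0, rowCoeff]
  by_cases hab : ∑ j, a j = b
  · have hs : ∏ j, (-1 * (v j / (σ * τ))) ^ a j = (-1) ^ b * ∏ j, (v j / (σ * τ)) ^ a j := by
      simp only [mul_pow, Finset.prod_mul_distrib, Finset.prod_pow_eq_pow_sum, hab]
    simp only [hab, if_true, true_and, one_mul, hs]
    rcases Nat.even_or_odd b with hb | hb
    · rw [if_pos hb, hb.neg_one_pow]; ring
    · rw [if_neg (Nat.not_even_iff_odd.2 hb), hb.neg_one_pow]; ring
  · simp [hab]

/-! ### The planted law -/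

/-- The data as a function on pairs of a row and a column, the column `none` being the response. -/
def coord {n p : ℕ} (X : Fin n → Fin p → ℝ) (y : Fin n → ℝ) : Fin n × Option (Fin p) → ℝ :=
  fun s => s.2.elim (y s.1) (X s.1)

lemma eval_coord_hermProd {n p : ℕ} (X : Fin n → Fin p → ℝ) (y : Fin n → ℝ)
    (g : Fin n × Option (Fin p) → ℕ) :
    MvPolynomial.eval (coord X y) (hermProd g) =
      ∏ i, (∏ j, (herm (g (i, some j))).eval (X i j)) * (herm (g (i, none))).eval (y i) := by
  simp only [eval_hermProd, Fintype.prod_prod_type, Fintype.prod_option, coord, Option.elim]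
  exact Finset.prod_congr rfl fun i _ => mul_comm _ _

/-- The joint law of the design, the signals, the labels and the noise. -/
def sourceLaw (n : ℕ) {p : ℕ} (π : Measure ((Fin p → ℝ) × (Fin p → ℝ))) :
    Measure ((Fin n → Fin p → ℝ) × ((Fin p → ℝ) × (Fin p → ℝ)) × (Fin n → ℝ) × (Fin n → ℝ)) :=
  (designLaw n p).prod (π.prod ((labelLaw n (1 / 2)).prod (noiseLaw n)))

section Planted

variable {n p : ℕ} {π : Measure ((Fin p → ℝ) × (Fin p → ℝ))} [IsProbabilityMeasure π]

instance : IsProbabilityMeasure (sourceLaw n π) := by unfold sourceLaw; infer_instance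

lemma measurePreserving_design_eval (i : Fin n) (j : Fin p) :
    MeasurePreserving (fun X : Fin n → Fin p → ℝ => X i j) (designLaw n p) (gaussianReal 0 1) :=
  (measurePreserving_eval (fun _ : Fin p => gaussianReal 0 1) j).comp
    (measurePreserving_eval (fun _ : Fin n => Measure.pi fun _ : Fin p => gaussianReal 0 1) i)

lemma measurePreserving_noise_eval (i : Fin n) :
    MeasurePreserving (fun w : Fin n → ℝ => w i) (noiseLaw n) (gaussianReal 0 1) :=
  measurePreserving_eval (fun _ : Fin n => gaussianReal 0 1) i

lemma measurePreserving_label_eval (i : Fin n) :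
    MeasurePreserving (fun w : Fin n → ℝ => w i) (labelLaw n (1 / 2)) labelLawOne :=
  measurePreserving_eval (fun _ : Fin n => labelLawOne) i

lemma hasMoments_design (i : Fin n) (j : Fin p) :
    HasMoments (fun t => t.1 i j) (sourceLaw n π) :=
  (hasMoments_gaussianReal.comp (measurePreserving_design_eval i j)).comp measurePreserving_fst

/-- Signals are bounded (the second through the symmetry), and Gaussians and labels have all
moments. This gives integrability of every polynomial in the data. -/
lemma hasMoments_response (σ : ℝ) {B : ℝ} (hB : ∀ᵐ b ∂π, ‖b.1‖ ≤ B) (hs : ∀ᵐ b ∂π, b.1 = -b.2)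
    (i : Fin n) :
    HasMoments (fun t => response σ t.1 t.2.1.1 t.2.1.2 t.2.2.1 t.2.2.2 i) (sourceLaw n π) := by
  have hx := hasMoments_design (n := n) (π := π) i
  have hz : HasMoments (fun t => t.2.2.1 i) (sourceLaw n π) :=
    (hasMoments_labelLawOne.comp (measurePreserving_label_eval i)).comp
      (measurePreserving_fst.comp (measurePreserving_snd.comp measurePreserving_snd))
  have hw : HasMoments (fun t => t.2.2.2 i) (sourceLaw n π) :=
    (hasMoments_gaussianReal.comp (measurePreserving_noise_eval i)).comp
      (measurePreserving_snd.comp (measurePreserving_snd.comp measurePreserving_snd))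
  have hπ : MeasurePreserving (fun t : (Fin n → Fin p → ℝ) × ((Fin p → ℝ) × (Fin p → ℝ)) ×
      (Fin n → ℝ) × (Fin n → ℝ) => t.2.1) (sourceLaw n π) π :=
    measurePreserving_fst.comp measurePreserving_snd
  have h1 : ∀ j, HasMoments (fun t => t.2.1.1 j) (sourceLaw n π) := fun j => by
    refine HasMoments.comp (f := fun b : (Fin p → ℝ) × (Fin p → ℝ) => b.1 j) ?_ hπ
    refine HasMoments.of_bound (by fun_prop) B ?_
    filter_upwards [hB] with b hb
    exact (norm_le_pi_norm b.1 j).trans hb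
  have h2 : ∀ j, HasMoments (fun t => t.2.1.2 j) (sourceLaw n π) := fun j => by
    refine HasMoments.comp (f := fun b : (Fin p → ℝ) × (Fin p → ℝ) => b.2 j) ?_ hπ
    refine HasMoments.of_bound (by fun_prop) B ?_
    filter_upwards [hB, hs] with b hb hb'
    rw [hb', norm_neg] at hb
    exact (norm_le_pi_norm b.2 j).trans hb
  have hl1 := ((HasMoments.sum Finset.univ fun j _ => (hx j).mul (h1 j)).const_mul σ⁻¹).mul hz
  have hl2 := ((HasMoments.sum Finset.univ fun j _ => (hx j).mul (h2 j)).const_mul σ⁻¹).mul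
    ((HasMoments.const 1).add (hz.const_mul (-1)))
  have := (hl1.add hl2).add hw
  convert this using 2
  simp only [response]
  ring

lemma hasMoments_coord (σ τ : ℝ) {B : ℝ} (hB : ∀ᵐ b ∂π, ‖b.1‖ ≤ B) (hs : ∀ᵐ b ∂π, b.1 = -b.2)
    (s : Fin n × Option (Fin p)) :
    HasMoments (fun t => coord t.1
      (fun i => τ⁻¹ * response σ t.1 t.2.1.1 t.2.1.2 t.2.2.1 t.2.2.2 i) s) (sourceLaw n π) := by
  obtain ⟨i, _ | j⟩ := s
  · exact (hasMoments_response σ hB hs i).const_mul _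
  · exact hasMoments_design i j

/-- The expectation of a Hermite product under the planted law. -/
lemma integral_source_hermProd {σ r τ B : ℝ} (hσ : 0 < σ) (hτ : 0 < τ)
    (hτ2 : τ ^ 2 = r ^ 2 / σ ^ 2 + 1) (hB : ∀ᵐ b ∂π, ‖b.1‖ ≤ B) (hs : ∀ᵐ b ∂π, b.1 = -b.2)
    (hr : ∀ᵐ b ∂π, ∑ j, b.1 j ^ 2 = r ^ 2) (g : Fin n × Option (Fin p) → ℕ) :
    ∫ t, MvPolynomial.eval (coord t.1
      (fun i => τ⁻¹ * response σ t.1 t.2.1.1 t.2.1.2 t.2.2.1 t.2.2.2 i)) (hermProd g)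
      ∂sourceLaw n π =
      ∫ b, ∏ i, rowCoeff (fun j => b.1 j / (σ * τ)) (fun j => g (i, some j)) (g (i, none)) ∂π := by
  have hint := (HasMoments.eval (hasMoments_coord (n := n) σ τ hB hs) (hermProd g)).integrable
  refine (integral_prodLeftComm (f := fun (b : (Fin p → ℝ) × (Fin p → ℝ)) X
    (u : (Fin n → ℝ) × (Fin n → ℝ)) => MvPolynomial.eval (coord X
      (fun i => τ⁻¹ * response σ X b.1 b.2 u.1 u.2 i)) (hermProd g)) hint).trans ?_
  refine integral_congr_ae ?_
  filter_upwards [hs, hr] with b hb hbr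
  obtain ⟨v, v'⟩ := b
  obtain rfl : v' = -v := by rw [show v = -v' from hb, neg_neg]
  simp only [eval_coord_hermProd, response]
  -- For a fixed signal pair the rows are independent.
  refine (integral_pi_prod_pi_prod_pi (Measure.pi fun _ : Fin p => gaussianReal 0 1) labelLawOne
    (gaussianReal 0 1) fun i x z w => (∏ j, (herm (g (i, some j))).eval (x j)) *
      (herm (g (i, none))).eval (τ⁻¹ * (σ⁻¹ * (∑ j, x j * v j) * z +
        σ⁻¹ * (∑ j, x j * (-v) j) * (1 - z) + w))).trans ?_
  exact Finset.prod_congr rfl fun i _ => integral_row hσ hτ hτ2 hbr _ _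

end Planted

/-! ### The null law -/

lemma hasMoments_coord_null {n p : ℕ} (s : Fin n × Option (Fin p)) :
    HasMoments (fun t => coord t.1 t.2 s) ((designLaw n p).prod (noiseLaw n)) := by
  obtain ⟨i, _ | j⟩ := s
  · exact (hasMoments_gaussianReal.comp (measurePreserving_noise_eval i)).comp
      measurePreserving_snd
  · exact (hasMoments_gaussianReal.comp (measurePreserving_design_eval i j)).comp
      measurePreserving_fst

/-- The product of the factorials of the exponents. -/
def factProd {κ : Type*} [Fintype κ] (g : κ → ℕ) : ℝ := ∏ s, ((g s).factorial : ℝ)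

lemma factProd_pos {κ : Type*} [Fintype κ] (g : κ → ℕ) : 0 < factProd g :=
  Finset.prod_pos fun _ _ => by positivity

/-- Orthogonality of the Hermite products under the null law. -/
lemma integral_null_hermProd_mul {n p : ℕ} (g g' : Fin n × Option (Fin p) → ℕ) :
    ∫ t, MvPolynomial.eval (coord t.1 t.2) (hermProd g) *
      MvPolynomial.eval (coord t.1 t.2) (hermProd g') ∂(designLaw n p).prod (noiseLaw n) =
      if g = g' then factProd g' else 0 := by
  have h1 : ∀ t : (Fin n → Fin p → ℝ) × (Fin n → ℝ),
      MvPolynomial.eval (coord t.1 t.2) (hermProd g) *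
        MvPolynomial.eval (coord t.1 t.2) (hermProd g') =
      (∏ i, ∏ j, (herm (g (i, some j))).eval (t.1 i j) * (herm (g' (i, some j))).eval (t.1 i j)) *
        ∏ i, (herm (g (i, none))).eval (t.2 i) * (herm (g' (i, none))).eval (t.2 i) := by
    intro t
    simp only [eval_coord_hermProd, Finset.prod_mul_distrib]
    ring
  simp only [h1]
  rw [integral_prod_mul (fun X : Fin n → Fin p → ℝ => ∏ i, ∏ j,
      (herm (g (i, some j))).eval (X i j) * (herm (g' (i, some j))).eval (X i j))
      (fun w : Fin n → ℝ => ∏ i, (herm (g (i, none))).eval (w i) *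
        (herm (g' (i, none))).eval (w i)),
    designLaw, noiseLaw,
    integral_fintype_prod_eq_prod (fun i (x : Fin p → ℝ) => ∏ j,
      (herm (g (i, some j))).eval (x j) * (herm (g' (i, some j))).eval (x j)),
    integral_fintype_prod_eq_prod (fun i (x : ℝ) => (herm (g (i, none))).eval x *
        (herm (g' (i, none))).eval x)]
  have h2 : ∀ i, ∫ x, ∏ j, (herm (g (i, some j))).eval (x j) * (herm (g' (i, some j))).eval (x j)
      ∂(Measure.pi fun _ : Fin p => gaussianReal 0 1) =
      ∏ j, if g (i, some j) = g' (i, some j) then ((g' (i, some j)).factorial : ℝ) else 0 := by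
    intro i
    rw [integral_fintype_prod_eq_prod (fun j (x : ℝ) => (herm (g (i, some j))).eval x *
      (herm (g' (i, some j))).eval x)]
    exact Finset.prod_congr rfl fun j _ => integral_herm_mul_herm _ _
  simp only [h2, integral_herm_mul_herm]
  rw [mul_comm, ← Finset.prod_mul_distrib]
  have h3 : ∏ s, (if g s = g' s then ((g' s).factorial : ℝ) else 0) =
      if g = g' then factProd g' else 0 := by
    rw [factProd]
    split_ifs with h
    · simp [h]
    · obtain ⟨s, hs⟩ := Function.ne_iff.1 h
      exact Finset.prod_eq_zero (Finset.mem_univ s) (if_neg hs)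
  rw [← h3, Fintype.prod_prod_type]
  simp only [Fintype.prod_option]

/-- Parseval's identity for the Hermite expansion. -/
lemma integral_null_sq {n p : ℕ} (Γ : Finset (Fin n × Option (Fin p) → ℕ))
    (c : (Fin n × Option (Fin p) → ℕ) → ℝ) :
    ∫ t, (MvPolynomial.eval (coord t.1 t.2) (∑ g ∈ Γ, c g • hermProd g)) ^ 2
      ∂(designLaw n p).prod (noiseLaw n) = ∑ g ∈ Γ, c g ^ 2 * factProd g := by
  have h1 : ∀ t : (Fin n → Fin p → ℝ) × (Fin n → ℝ),
      (MvPolynomial.eval (coord t.1 t.2) (∑ g ∈ Γ, c g • hermProd g)) ^ 2 =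
      ∑ g ∈ Γ, ∑ g' ∈ Γ, c g * c g' * (MvPolynomial.eval (coord t.1 t.2) (hermProd g) *
        MvPolynomial.eval (coord t.1 t.2) (hermProd g')) := by
    intro t
    rw [map_sum, sq, Finset.sum_mul_sum]
    refine Finset.sum_congr rfl fun g _ => Finset.sum_congr rfl fun g' _ => ?_
    rw [MvPolynomial.smul_eval, MvPolynomial.smul_eval]
    ring
  simp only [h1]
  have hint : ∀ g g', Integrable (fun t : (Fin n → Fin p → ℝ) × (Fin n → ℝ) =>
      c g * c g' * (MvPolynomial.eval (coord t.1 t.2) (hermProd g) *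
        MvPolynomial.eval (coord t.1 t.2) (hermProd g'))) ((designLaw n p).prod (noiseLaw n)) :=
    fun g g' => (((HasMoments.eval hasMoments_coord_null (hermProd g)).mul
      (HasMoments.eval hasMoments_coord_null (hermProd g'))).const_mul _).integrable
  rw [integral_finsetSum _ fun g _ => integrable_finsetSum _ fun g' _ => hint g g']
  refine Finset.sum_congr rfl fun g hg => ?_
  rw [integral_finsetSum _ fun g' _ => hint g g']
  simp only [integral_const_mul, integral_null_hermProd_mul]
  rw [Finset.sum_eq_single g]
  · simp [sq]
  · intro g' _ h
    simp [h.symm]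
  · simp [hg]

/-! ### The data vector -/

/-- The row and column of an entry of the data vector. -/
def dataIndex {n p : ℕ} (s : Fin (n * (p + 1))) : Fin n × Option (Fin p) :=
  ((finProdFinEquiv.symm s).1, finSuccEquivLast (finProdFinEquiv.symm s).2)

lemma dataVec_apply {n p : ℕ} (X : Fin n → Fin p → ℝ) (y : Fin n → ℝ) (s : Fin (n * (p + 1))) :
    dataVec X y s = coord X y (dataIndex s) := by
  unfold dataVec dataIndex coord
  generalize finProdFinEquiv.symm s = q
  obtain ⟨i, j⟩ := q
  refine Fin.lastCases ?_ (fun j => ?_) j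
  · simp
  · simp

/-- Normalizing the response is a diagonal substitution, which does not raise the degree of a
polynomial. -/
lemma dataVec_mul_apply {n p : ℕ} (τ : ℝ) (X : Fin n → Fin p → ℝ) (y : Fin n → ℝ)
    (s : Fin (n * (p + 1))) :
    dataVec X (fun i => τ * y i) s =
      (dataIndex s).2.elim τ (fun _ => 1) * coord X y (dataIndex s) := by
  rw [dataVec_apply]
  obtain ⟨i, _ | j⟩ := dataIndex s <;> simp [coord]

lemma eval_aeval {τ κ : Type*} (φ : τ → MvPolynomial κ ℝ) (x : κ → ℝ) (f : MvPolynomial τ ℝ) :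
    MvPolynomial.eval x (MvPolynomial.aeval φ f) =
      MvPolynomial.eval (fun s => MvPolynomial.eval x (φ s)) f := by
  induction f using MvPolynomial.induction_on with
  | C a => simp
  | add p q hp hq => rw [map_add, map_add, map_add, hp, hq]
  | mul_X p s hp => rw [map_mul, map_mul, map_mul, hp, MvPolynomial.aeval_X, MvPolynomial.eval_X]

/-- A polynomial in the data is a combination of Hermite products in the normalized data. -/
lemma exists_data_expansion {n p D : ℕ} (τ : ℝ) (f : MvPolynomial (Fin (n * (p + 1))) ℝ)
    (hf : f.totalDegree ≤ D) :
    ∃ c : (Fin n × Option (Fin p) → ℕ) → ℝ, ∀ (X : Fin n → Fin p → ℝ) (y : Fin n → ℝ),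
      MvPolynomial.eval (dataVec X fun i => τ * y i) f =
      MvPolynomial.eval (coord X y) (∑ g ∈ exponents (Fin n × Option (Fin p)) D, c g • hermProd g) := by
  obtain ⟨c, hc⟩ := exists_hermite_expansion dataIndex
    (fun s => (dataIndex s).2.elim τ (fun _ => 1)) f hf
  refine ⟨c, fun X y => ?_⟩
  rw [← hc, eval_aeval]
  congr 1
  simp only [map_mul, MvPolynomial.eval_C, MvPolynomial.eval_X]
  congr 1
  funext s
  exact dataVec_mul_apply τ X y s

lemma measurable_coord {n p : ℕ} {Ω : Type*} [MeasurableSpace Ω] {X : Ω → Fin n → Fin p → ℝ}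
    {y : Ω → Fin n → ℝ} (hX : Measurable X) (hy : Measurable y) (s : Fin n × Option (Fin p)) :
    Measurable fun t => coord (X t) (y t) s := by
  obtain ⟨i, _ | j⟩ := s
  · exact (measurable_pi_apply i).comp hy
  · exact (measurable_pi_apply j).comp ((measurable_pi_apply i).comp hX)

lemma measurable_dataVec {n p : ℕ} {Ω : Type*} [MeasurableSpace Ω] {X : Ω → Fin n → Fin p → ℝ}
    {y : Ω → Fin n → ℝ} (hX : Measurable X) (hy : Measurable y) :
    Measurable fun t => dataVec (X t) (y t) := by
  refine measurable_pi_lambda _ fun s => ?_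
  simp only [dataVec_apply]
  exact measurable_coord hX hy _

lemma measurable_response {n p : ℕ} (σ : ℝ) :
    Measurable fun t : (Fin n → Fin p → ℝ) × ((Fin p → ℝ) × (Fin p → ℝ)) × (Fin n → ℝ) ×
      (Fin n → ℝ) => response σ t.1 t.2.1.1 t.2.1.2 t.2.2.1 t.2.2.2 := by
  refine measurable_pi_lambda _ fun i => ?_
  unfold response
  fun_prop

/-- The sum of the squared normalized Hermite coefficients of the planted law up to degree `D`. -/
def coeffEnergy (n D : ℕ) {p : ℕ} (π : Measure ((Fin p → ℝ) × (Fin p → ℝ))) (s : ℝ) : ℝ :=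
  ∑ g ∈ exponents (Fin n × Option (Fin p)) D,
    (∫ b, ∏ i, rowCoeff (fun j => b.1 j / s) (fun j => g (i, some j)) (g (i, none)) ∂π) ^ 2 /
      factProd g

/-- The low-degree divergence is controlled by the Hermite coefficients. -/
theorem chiSqLE_le_coeffEnergy {n p D : ℕ} {π : Measure ((Fin p → ℝ) × (Fin p → ℝ))}
    [IsProbabilityMeasure π] {σ r B : ℝ} (hσ : 0 < σ) (hB : ∀ᵐ b ∂π, ‖b.1‖ ≤ B)
    (hs : ∀ᵐ b ∂π, b.1 = -b.2) (hr : ∀ᵐ b ∂π, ∑ j, b.1 j ^ 2 = r ^ 2) :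
    chiSqLE D (planted n σ (1 / 2) π) (null n p σ r) ≤
      ENNReal.ofReal (coeffEnergy n D π (σ * Real.sqrt (r ^ 2 / σ ^ 2 + 1))) := by
  set τ := Real.sqrt (r ^ 2 / σ ^ 2 + 1) with hτdef
  have hτ : 0 < τ := Real.sqrt_pos.2 (by positivity)
  have hτ2 : τ ^ 2 = r ^ 2 / σ ^ 2 + 1 := Real.sq_sqrt (by positivity)
  -- The energy bounds the supremum itself, so the subtracted 1 is given away.
  refine tsub_le_self.trans (iSup_le fun f => iSup_le fun hf => iSup_le fun _ => ?_)
  obtain ⟨c, hc⟩ := exists_data_expansion τ f hf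
  set Γ := exponents (Fin n × Option (Fin p)) D
  have hfm : Measurable fun x => MvPolynomial.eval x f := (MvPolynomial.continuous_eval f).measurable
  have hT := measurable_dataVec (measurable_fst) (measurable_response (n := n) (p := p) σ)
  have hP : ∀ t : (Fin n → Fin p → ℝ) × ((Fin p → ℝ) × (Fin p → ℝ)) × (Fin n → ℝ) × (Fin n → ℝ),
      MvPolynomial.eval (dataVec t.1 (response σ t.1 t.2.1.1 t.2.1.2 t.2.2.1 t.2.2.2)) f =
      MvPolynomial.eval (coord t.1
        (fun i => τ⁻¹ * response σ t.1 t.2.1.1 t.2.1.2 t.2.2.1 t.2.2.2 i))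
        (∑ g ∈ Γ, c g • hermProd g) := by
    intro t
    rw [← hc]
    congr 2
    funext i
    field_simp
  have hmom := fun q => HasMoments.eval (hasMoments_coord (n := n) σ τ hB hs) q
  have hintP : Integrable (fun x => MvPolynomial.eval x f) (planted n σ (1 / 2) π) := by
    refine (integrable_map_measure hfm.aestronglyMeasurable hT.aemeasurable).2 ?_
    exact ((hmom _).integrable).congr (ae_of_all _ fun t => (hP t).symm)
  have hEP : ∫ x, MvPolynomial.eval x f ∂planted n σ (1 / 2) π = ∑ g ∈ Γ, c g *
      ∫ b, ∏ i, rowCoeff (fun j => b.1 j / (σ * τ)) (fun j => g (i, some j)) (g (i, none)) ∂π := by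
    refine (integral_map hT.aemeasurable hfm.aestronglyMeasurable).trans ?_
    simp only [hP, map_sum, MvPolynomial.smul_eval]
    refine (integral_finsetSum (μ := sourceLaw n π) _
      fun g _ => ((hmom (hermProd g)).const_mul (c g)).integrable).trans ?_
    refine Finset.sum_congr rfl fun g _ => ?_
    rw [integral_const_mul, integral_source_hermProd hσ hτ hτ2 hB hs hr]
  have hEQ : ∫⁻ x, ENNReal.ofReal (MvPolynomial.eval x f ^ 2) ∂null n p σ r =
      ENNReal.ofReal (∑ g ∈ Γ, c g ^ 2 * factProd g) := by
    rw [← integral_null_sq, null, lintegral_map (by fun_prop)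
      (measurable_dataVec measurable_fst (by fun_prop)),
      ofReal_integral_eq_lintegral_ofReal _ (ae_of_all _ fun _ => sq_nonneg _)]
    · exact lintegral_congr fun t => by rw [hc]
    · have h1 := HasMoments.eval (hasMoments_coord_null (n := n) (p := p))
        (∑ g ∈ Γ, c g • hermProd g)
      simpa only [sq] using (h1.mul h1).integrable
  rw [testRatio, if_pos hintP, hEQ, hEP]
  refine ENNReal.div_le_of_le_mul ?_
  rw [coeffEnergy, ← ENNReal.ofReal_mul (Finset.sum_nonneg fun g _ =>
    div_nonneg (sq_nonneg _) (factProd_pos g).le)]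
  refine ENNReal.ofReal_le_ofReal ?_
  -- Cauchy–Schwarz with weights: the square of coefficient times planted mean is (mean²/g!)·(c_g²
  -- g!), where g! denotes `factProd g`.
  refine Finset.sum_sq_le_sum_mul_sum_of_sq_le_mul _
    (fun g _ => div_nonneg (sq_nonneg _) (factProd_pos g).le)
    (fun g _ => mul_nonneg (sq_nonneg _) (factProd_pos g).le) fun g _ => ?_
  have := (factProd_pos g).ne'
  refine le_of_eq ?_
  field_simp

/-! ### The coefficient energy as an expectation over two independent signals -/

/-- The multinomial theorem: (2d)!² divided by (2d)! a! is the multinomial coefficient of a. -/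
lemma sum_rowCoeff_mul {p : ℕ} (θ θ' : Fin p → ℝ) (d : ℕ) :
    ∑ a ∈ Finset.piAntidiag Finset.univ (2 * d),
      rowCoeff θ a (2 * d) * rowCoeff θ' a (2 * d) / (((2 * d).factorial : ℝ) * factProd a) =
      (∑ j, θ j * θ' j) ^ (2 * d) := by
  rw [Finset.sum_pow_eq_sum_piAntidiag]
  refine Finset.sum_congr rfl fun a ha => ?_
  have ha' : ∑ j, a j = 2 * d := (Finset.mem_piAntidiag.1 ha).1
  have hspec : factProd a * (Nat.multinomial Finset.univ a : ℝ) = ((2 * d).factorial : ℝ) := by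
    have := Nat.multinomial_spec Finset.univ a
    rw [ha'] at this
    rw [← this, factProd]
    push_cast
    rfl
  have h1 := (factProd_pos a).ne'
  have h2 : ((2 * d).factorial : ℝ) ≠ 0 := by positivity
  rw [rowCoeff, rowCoeff, if_pos ⟨ha', even_two_mul d⟩, if_pos ⟨ha', even_two_mul d⟩,
    div_eq_iff (mul_ne_zero h2 h1)]
  simp only [mul_pow, Finset.prod_mul_distrib]
  rw [← hspec]
  ring

/-- The exponents of the Hermite products with a nonzero coefficient. -/
def joinExponents {n p : ℕ} (x : (_ : Fin n → ℕ) × (Fin n → Fin p → ℕ)) :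
    Fin n × Option (Fin p) → ℕ := fun s => s.2.elim (2 * x.1 s.1) (x.2 s.1)

lemma factProd_eq_prod_rows {n p : ℕ} (g : Fin n × Option (Fin p) → ℕ) :
    factProd g = ∏ i, ((g (i, none)).factorial : ℝ) * factProd fun j => g (i, some j) := by
  simp only [factProd, Fintype.prod_prod_type, Fintype.prod_option]

/-- Only rows with response degree 2dᵢ and design degree 2dᵢ contribute. Such a row uses degree 4dᵢ,
which is where D / 4 comes from; the design exponents are then summed out row by row. -/
lemma sum_exponents_rowCoeff (n D : ℕ) {p : ℕ} (θ θ' : Fin p → ℝ) :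
    ∑ g ∈ exponents (Fin n × Option (Fin p)) D,
      (∏ i, rowCoeff θ (fun j => g (i, some j)) (g (i, none))) *
        (∏ i, rowCoeff θ' (fun j => g (i, some j)) (g (i, none))) / factProd g =
      ∑ d ∈ exponents (Fin n) (D / 4), (∑ j, θ j * θ' j) ^ (2 * ∑ i, d i) := by
  have hrow : ∀ d : Fin n → ℕ, (∑ j, θ j * θ' j) ^ (2 * ∑ i, d i) =
      ∑ A ∈ Fintype.piFinset fun i => Finset.piAntidiag (Finset.univ : Finset (Fin p)) (2 * d i),
        ∏ i, rowCoeff θ (A i) (2 * d i) * rowCoeff θ' (A i) (2 * d i) /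
          (((2 * d i).factorial : ℝ) * factProd (A i)) := by
    intro d
    rw [← Finset.prod_univ_sum (fun i => Finset.piAntidiag (Finset.univ : Finset (Fin p)) (2 * d i))
      fun i a => rowCoeff θ a (2 * d i) * rowCoeff θ' a (2 * d i) /
          (((2 * d i).factorial : ℝ) * factProd a)]
    simp only [sum_rowCoeff_mul, Finset.prod_pow_eq_pow_sum, Finset.mul_sum]
  simp only [hrow]
  rw [Finset.sum_sigma']
  symm
  have hmem : ∀ x : (_ : Fin n → ℕ) × (Fin n → Fin p → ℕ),
      x ∈ (exponents (Fin n) (D / 4)).sigma (fun d => Fintype.piFinset fun i =>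
        Finset.piAntidiag (Finset.univ : Finset (Fin p)) (2 * d i)) ↔
      ∑ i, x.1 i ≤ D / 4 ∧ ∀ i, ∑ j, x.2 i j = 2 * x.1 i := by
    intro x
    simp [Finset.mem_sigma, mem_exponents, Fintype.mem_piFinset]
  refine Finset.sum_of_injOn joinExponents ?_ ?_ ?_ ?_
  · rintro ⟨d, A⟩ _ ⟨d', A'⟩ _ h
    obtain rfl : d = d' := by
      funext i
      have := congrFun h (i, none)
      simp only [joinExponents, Option.elim] at this
      omega
    obtain rfl : A = A' := by
      funext i j
      exact congrFun h (i, some j)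
    rfl
  · intro x hx
    rw [Finset.mem_coe, hmem] at hx
    rw [Finset.mem_coe, mem_exponents]
    simp only [joinExponents, Fintype.sum_prod_type, Fintype.sum_option, Option.elim, hx.2,
      Finset.sum_add_distrib, ← Finset.mul_sum]
    omega
  · intro g hg hg'
    by_cases h : ∀ i, ∑ j, g (i, some j) = g (i, none) ∧ Even (g (i, none))
    · refine absurd ⟨⟨fun i => g (i, none) / 2, fun i j => g (i, some j)⟩, ?_, ?_⟩ hg'
      · have he : ∀ i, 2 * (g (i, none) / 2) = g (i, none) := fun i =>
          Nat.two_mul_div_two_of_even (h i).2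
        rw [Finset.mem_coe, hmem]
        refine ⟨?_, fun i => by simp only [he, (h i).1]⟩
        rw [mem_exponents] at hg
        simp only [Fintype.sum_prod_type, Fintype.sum_option, (h _).1,
          Finset.sum_add_distrib] at hg
        have : 2 * ∑ i, g (i, none) / 2 = ∑ i, g (i, none) := by
          rw [Finset.mul_sum]
          exact Finset.sum_congr rfl fun i _ => he i
        simp only
        omega
      · funext ⟨i, o⟩
        rcases o with _ | j
        · simpa [joinExponents] using Nat.two_mul_div_two_of_even (h i).2
        · rfl
    · push Not at h
      obtain ⟨i, hi⟩ := h
      have : rowCoeff θ (fun j => g (i, some j)) (g (i, none)) = 0 :=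
        if_neg fun h => hi h.1 h.2
      rw [Finset.prod_eq_zero (Finset.mem_univ i) this]
      simp
  · rintro ⟨d, A⟩ _
    rw [factProd_eq_prod_rows, ← Finset.prod_mul_distrib, ← Finset.prod_div_distrib]
    rfl

lemma hasMoments_rowCoeff {n p : ℕ} {π : Measure ((Fin p → ℝ) × (Fin p → ℝ))}
    [IsProbabilityMeasure π] {B : ℝ} (hB : ∀ᵐ b ∂π, ‖b.1‖ ≤ B) (s : ℝ)
    (g : Fin n × Option (Fin p) → ℕ) :
    HasMoments (fun b => ∏ i, rowCoeff (fun j => b.1 j / s) (fun j => g (i, some j))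
      (g (i, none))) π := by
  have hj : ∀ j, HasMoments (fun b => b.1 j / s) π := fun j => by
    simp only [div_eq_inv_mul]
    refine HasMoments.const_mul _ (HasMoments.of_bound (by fun_prop) B ?_)
    filter_upwards [hB] with b hb
    exact (norm_le_pi_norm b.1 j).trans hb
  refine HasMoments.prod _ fun i _ => ?_
  unfold rowCoeff
  split_ifs
  · refine HasMoments.const_mul _ (HasMoments.prod _ fun j _ => ?_)
    simpa using (hj j).polynomial_eval (Polynomial.X ^ g (i, some j))
  · exact HasMoments.const 0

/-- The coefficient energy is the expectation of a truncated power series in the overlap of two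
independent signals. -/
theorem coeffEnergy_eq {n D p : ℕ} {π : Measure ((Fin p → ℝ) × (Fin p → ℝ))}
    [IsProbabilityMeasure π] {B : ℝ} (hB : ∀ᵐ b ∂π, ‖b.1‖ ≤ B) (s : ℝ) :
    coeffEnergy n D π s = ∫ u, ∑ d ∈ exponents (Fin n) (D / 4),
      (∑ j, u.1.1 j / s * (u.2.1 j / s)) ^ (2 * ∑ i, d i) ∂π.prod π := by
  simp only [← sum_exponents_rowCoeff]
  rw [integral_finsetSum]
  · refine Finset.sum_congr rfl fun g _ => ?_
    -- A squared mean is the mean of a product over two independent copies of the signal.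
    rw [integral_div, integral_prod_mul
      (fun b : (Fin p → ℝ) × (Fin p → ℝ) => ∏ i, rowCoeff (fun j => b.1 j / s)
        (fun j => g (i, some j)) (g (i, none)))
      (fun b : (Fin p → ℝ) × (Fin p → ℝ) => ∏ i, rowCoeff (fun j => b.1 j / s)
        (fun j => g (i, some j)) (g (i, none))), sq]
  · intro g _
    have h := hasMoments_rowCoeff (n := n) hB s g
    exact ((h.integrable.mul_prod h.integrable).div_const _)

/-! ### Bounding the power series -/

lemma card_piAntidiag_le (n s : ℕ) :
    ((Finset.piAntidiag (Finset.univ : Finset (Fin n)) s).card : ℝ) ≤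
      (n + s : ℝ) ^ s / s.factorial := by
  have h1 : (Finset.piAntidiag (Finset.univ : Finset (Fin n)) s).card = (n + s - 1).choose s := by
    have := Finset.card_finsuppAntidiag_nat_eq_choose (s := (Finset.univ : Finset (Fin n))) s
    rw [Finset.finsuppAntidiag, Finset.card_map, Finset.card_attach] at this
    simpa using this
  rw [h1]
  refine (Nat.choose_le_pow_div s (n + s - 1)).trans ?_
  gcongr
  exact_mod_cast Nat.sub_le _ _

lemma sum_exponents_eq (n m : ℕ) (f : ℕ → ℝ) :
    ∑ d ∈ exponents (Fin n) m, f (∑ i, d i) = ∑ s ∈ Finset.range (m + 1),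
      ((Finset.piAntidiag (Finset.univ : Finset (Fin n)) s).card : ℝ) * f s := by
  rw [← Finset.sum_fiberwise_of_maps_to (s := exponents (Fin n) m) (t := Finset.range (m + 1))
    (g := fun d => ∑ i, d i) fun d hd => by
      rw [mem_exponents] at hd; exact Finset.mem_range.2 (by omega)]
  refine Finset.sum_congr rfl fun s hs => ?_
  rw [Finset.sum_congr rfl (g := fun _ => f s) fun d hd => by rw [(Finset.mem_filter.1 hd).2],
    Finset.sum_const, nsmul_eq_mul]
  congr 3
  ext d
  simp only [Finset.mem_filter, mem_exponents, Finset.mem_piAntidiag, Finset.mem_univ,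
    implies_true, and_true, and_iff_right_iff_imp]
  intro h
  have := Finset.mem_range.1 hs
  omega

/-- Write (2s)! as the central binomial coefficient times s!², and bound the former by 4^s and one
factorial by s^s. The remaining s! cancels the denominator in `card_piAntidiag_le`. -/
lemma factorial_two_mul_le (s : ℕ) :
    ((2 * s).factorial : ℝ) ≤ 4 ^ s * s ^ s * s.factorial := by
  have h1 : (2 * s).factorial = s.centralBinom * s.factorial * s.factorial := by
    have := Nat.choose_mul_factorial_mul_factorial (n := 2 * s) (k := s) (by omega)
    rw [← this, Nat.centralBinom, show 2 * s - s = s by omega]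
  have h2 : s.centralBinom ≤ 4 ^ s := by
    have := Nat.choose_le_two_pow (2 * s) s
    rwa [pow_mul] at this
  have h3 : s.factorial ≤ s ^ s := Nat.factorial_le_pow s
  rw [h1]
  have : s.centralBinom * s.factorial * s.factorial ≤ 4 ^ s * s ^ s * s.factorial := by gcongr
  exact_mod_cast this

/-- The truncated power series is at most `exp z` if the truncation level is small enough. -/
lemma sum_exponents_le_exp {n D : ℕ} {A t z : ℝ} (hz : 0 ≤ z)
    (ht : n * A * t ^ 2 ≤ z ^ 2) (hDn : (D : ℝ) ≤ 2 * (Real.sqrt 2 - 1) * n)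
    (hDA : (D : ℝ) ≤ 2 * (Real.sqrt 2 - 1) * A) :
    ∑ d ∈ exponents (Fin n) (D / 4), t ^ (2 * ∑ i, d i) ≤ Real.exp z := by
  have hq : Real.sqrt 2 ^ 2 = 2 := Real.sq_sqrt (by norm_num)
  have hq1 : 1 < Real.sqrt 2 := by
    rw [Real.lt_sqrt (by norm_num)]; norm_num
  set q := Real.sqrt 2 with hqdef
  rw [sum_exponents_eq n (D / 4) fun s => t ^ (2 * s)]
  have hterm : ∀ s ∈ Finset.range (D / 4 + 1),
      ((Finset.piAntidiag (Finset.univ : Finset (Fin n)) s).card : ℝ) * t ^ (2 * s) ≤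
        z ^ (2 * s) / (2 * s).factorial := by
    intro s hs
    rcases Nat.eq_zero_or_pos s with rfl | hs0
    · simp
    have hsD : (4 * s : ℝ) ≤ D := by
      have : 4 * s ≤ D := by
        have := Finset.mem_range.1 hs
        omega
      exact_mod_cast this
    have hs1 : (0 : ℝ) < s := by exact_mod_cast hs0
    -- From 4s ≤ D ≤ 2(q - 1)n one has s ≤ n(q - 1)/2. The next bound uses (q - 1)(q + 1) = 1;
    -- together they give (n + s)·4s ≤ nA, which explains the constant 2(√2 - 1).
    have hb1 : (n + s : ℝ) ≤ n * ((q + 1) / 2) := by nlinarith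
    have hb2 : (s : ℝ) * (2 * (q + 1)) ≤ A := by
      have : (4 * s : ℝ) * (q + 1) ≤ 2 * (q - 1) * A * (q + 1) :=
        mul_le_mul_of_nonneg_right (hsD.trans hDA) (by linarith)
      nlinarith
    have hb3 : (n + s : ℝ) * (4 * s) * t ^ 2 ≤ z ^ 2 := by
      have h1 : (n + s : ℝ) * (4 * s) ≤ n * A := by
        calc (n + s : ℝ) * (4 * s) ≤ n * ((q + 1) / 2) * (4 * s) := by gcongr
          _ = n * (s * (2 * (q + 1))) := by ring
          _ ≤ n * A := by gcongr
      exact (mul_le_mul_of_nonneg_right h1 (sq_nonneg t)).trans ht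
    have hb4 : (n + s : ℝ) ^ s * (4 ^ s * s ^ s) * t ^ (2 * s) ≤ z ^ (2 * s) := by
      rw [pow_mul, pow_mul, ← mul_pow, ← mul_pow, ← mul_pow]
      exact pow_le_pow_left₀ (by positivity) hb3 s
    have hfac := factorial_two_mul_le s
    have hf0 : (0 : ℝ) < s.factorial := by positivity
    rw [le_div_iff₀ (by positivity)]
    have ht0 : 0 ≤ t ^ (2 * s) := by rw [pow_mul]; positivity
    calc ((Finset.piAntidiag (Finset.univ : Finset (Fin n)) s).card : ℝ) * t ^ (2 * s) *
          (2 * s).factorial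
        ≤ (n + s : ℝ) ^ s / s.factorial * t ^ (2 * s) * (4 ^ s * s ^ s * s.factorial) := by
          gcongr
          exact card_piAntidiag_le n s
      _ = (n + s : ℝ) ^ s * (4 ^ s * s ^ s) * t ^ (2 * s) := by
          field_simp
      _ ≤ z ^ (2 * s) := hb4
  refine (Finset.sum_le_sum hterm).trans ?_
  -- The bounds are the even-index terms of the exponential series.
  refine le_trans ?_ (Real.sum_le_exp_of_nonneg hz (2 * (D / 4 + 1)))
  refine (Finset.sum_image (f := fun i => z ^ i / (i.factorial : ℝ)) (g := fun s => 2 * s)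
    (fun a _ b _ h => by simpa using h)).symm.trans_le ?_
  refine Finset.sum_le_sum_of_subset_of_nonneg ?_ fun i _ _ => by positivity
  intro i hi
  obtain ⟨s, hs, rfl⟩ := Finset.mem_image.1 hi
  have := Finset.mem_range.1 hs
  exact Finset.mem_range.2 (by omega)

/-! ### The overlap of two random supports -/

/-- Deleting T is injective on the sets containing T. -/
lemma card_superset_le {p : ℕ} (k : ℕ) (T : Finset (Fin p)) :
    ((Finset.powersetCard k (Finset.univ : Finset (Fin p))).filter (T ⊆ ·)).card ≤
      (p - T.card).choose (k - T.card) := by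
  rw [show p - T.card = (Finset.univ \ T).card by
    rw [Finset.card_sdiff_of_subset (Finset.subset_univ T)]; simp,
    ← Finset.card_powersetCard]
  refine Finset.card_le_card_of_injOn (· \ T) ?_ ?_
  · intro S hS
    rw [Finset.mem_coe, Finset.mem_filter, Finset.mem_powersetCard] at hS
    rw [Finset.mem_coe, Finset.mem_powersetCard]
    refine ⟨Finset.sdiff_subset_sdiff (Finset.subset_univ S) le_rfl, ?_⟩
    rw [Finset.card_sdiff_of_subset hS.2, hS.1.2]
  · intro S hS S' hS' h
    rw [Finset.mem_coe, Finset.mem_filter] at hS hS'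
    rw [← Finset.sdiff_union_of_subset hS.2, ← Finset.sdiff_union_of_subset hS'.2]
    exact congrArg (· ∪ T) h

/-- A uniform k-set contains a given t-set with probability ∏ (k - i)/(p - i) over i < t, and each
factor is at most k/p. -/
lemma choose_sub_mul_pow_le {p k t : ℕ} (hk : k ≤ p) (ht : t ≤ k) :
    (p - t).choose (k - t) * p ^ t ≤ p.choose k * k ^ t := by
  induction t with
  | zero => simp
  | succ t ih =>
    have h1 := Nat.add_one_mul_choose_eq (p - (t + 1)) (k - (t + 1))
    rw [show p - (t + 1) + 1 = p - t by omega, show k - (t + 1) + 1 = k - t by omega] at h1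
    have h2 := ih (by omega)
    have h3 : (k - t) * p ≤ (p - t) * k := by
      rw [Nat.sub_mul, Nat.sub_mul, mul_comm p k]
      exact Nat.sub_le_sub_left (Nat.mul_le_mul_left t hk) _
    have h4 : 0 < p - t := by omega
    refine Nat.le_of_mul_le_mul_left ?_ h4
    calc (p - t) * ((p - (t + 1)).choose (k - (t + 1)) * p ^ (t + 1))
        = (p - t) * (p - (t + 1)).choose (k - (t + 1)) * (p ^ t * p) := by ring
      _ = (p - t).choose (k - t) * p ^ t * ((k - t) * p) := by rw [h1]; ring
      _ ≤ p.choose k * k ^ t * ((p - t) * k) := Nat.mul_le_mul h2 h3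
      _ = (p - t) * (p.choose k * k ^ (t + 1)) := by ring

/-- The exponential moment of a hypergeometric variable. -/
lemma sum_powersetCard_pow_le {p k : ℕ} (hk : k ≤ p) {S : Finset (Fin p)}
    (hS : S.card = k) {x : ℝ} (hx : 0 ≤ x) :
    ∑ S' ∈ Finset.powersetCard k (Finset.univ : Finset (Fin p)), (1 + x) ^ (S ∩ S').card ≤
      p.choose k * (1 + x * (k / p)) ^ k := by
  -- Expanding over the subsets T of S ∩ S' reduces the moment to counting the k-sets that contain
  -- T. The binomial theorem over T ⊆ S resums the bounds at the end.
  have h1 : ∀ S' : Finset (Fin p), (1 + x) ^ (S ∩ S').card =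
      ∑ T ∈ S.powerset, if T ⊆ S' then x ^ T.card else 0 := by
    intro S'
    rw [← Finset.sum_filter, ← Finset.prod_const, Finset.prod_one_add]
    refine Finset.sum_congr ?_ fun T _ => Finset.prod_const x
    ext T
    simp only [Finset.mem_powerset, Finset.subset_inter_iff, Finset.mem_filter]
  simp only [h1]
  rw [Finset.sum_comm]
  have h2 : ∀ T ∈ S.powerset, ∑ S' ∈ Finset.powersetCard k (Finset.univ : Finset (Fin p)),
      (if T ⊆ S' then x ^ T.card else 0) ≤ p.choose k * (x * (k / p)) ^ T.card := by
    intro T hT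
    have hTk : T.card ≤ k := hS ▸ Finset.card_le_card (Finset.mem_powerset.1 hT)
    have hpos : (0 : ℝ) < (p : ℝ) ^ T.card := by
      rcases Nat.eq_zero_or_pos p with rfl | hp
      · simp [show T.card = 0 by omega]
      · positivity
    rw [← Finset.sum_filter, Finset.sum_const, nsmul_eq_mul, mul_pow, mul_left_comm, mul_comm]
    refine mul_le_mul_of_nonneg_left ?_ (by positivity)
    rw [div_pow, ← mul_div_assoc, le_div_iff₀ hpos]
    have := (Nat.mul_le_mul_right (p ^ T.card) (card_superset_le k T)).trans
      (choose_sub_mul_pow_le hk hTk)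
    exact_mod_cast this
  refine (Finset.sum_le_sum h2).trans_eq ?_
  rw [← Finset.mul_sum, ← hS, ← Finset.prod_const, Finset.prod_one_add]
  simp only [Finset.prod_const]

/-! ### Signals with a uniform support -/

lemma mem_supp {p : ℕ} {v : Fin p → ℝ} {j : Fin p} : j ∈ supp v ↔ v j ≠ 0 := by simp [supp]

lemma measurableSet_supp_eq {p : ℕ} (S : Finset (Fin p)) :
    MeasurableSet {v : Fin p → ℝ | supp v = S} := by
  have : {v : Fin p → ℝ | supp v = S} = ⋂ j, {v | v j ≠ 0 ↔ j ∈ S} := by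
    ext v
    simp [Finset.ext_iff, mem_supp]
  rw [this]
  refine MeasurableSet.iInter fun j => ?_
  have h0 : MeasurableSet {v : Fin p → ℝ | v j = 0} :=
    measurable_pi_apply j (measurableSet_singleton 0)
  by_cases hj : j ∈ S
  · simp only [hj, iff_true]
    exact h0.compl
  · simpa [hj] using h0

/-- Only the support has a prescribed law, so the entries have to be bounded away before averaging.
-/
lemma IsSignalLaw.integral_supp {p k : ℕ} {r : ℝ} {𝒟 : Set ℝ} {μ : Measure (Fin p → ℝ)}
    (h : IsSignalLaw k r 𝒟 μ) (φ : Finset (Fin p) → ℝ) :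
    ∫ v, φ (supp v) ∂μ =
      (∑ S ∈ Finset.powersetCard k Finset.univ, φ S) / (p.choose k : ℝ) := by
  have := h.prob
  have h1 : ∀ᵐ v ∂μ, φ (supp v) = ∑ S ∈ Finset.powersetCard k Finset.univ,
      {v : Fin p → ℝ | supp v = S}.indicator (fun _ => φ S) v := by
    filter_upwards [h.sparse] with v hv
    simp [Set.indicator_apply, Finset.mem_powersetCard, hv]
  rw [integral_congr_ae h1, integral_finsetSum _ fun S _ =>
    (integrable_const _).indicator (measurableSet_supp_eq S), Finset.sum_div]
  refine Finset.sum_congr rfl fun S hS => ?_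
  rw [integral_indicator_const _ (measurableSet_supp_eq S), measureReal_def,
    h.supp_uniform S (Finset.mem_powersetCard.1 hS).2]
  simp [div_eq_inv_mul]

/-- A single typical signal witnesses this: its k nonzero entries each contribute at least β_min² to
r². -/
lemma IsSignalLaw.mul_bMin_sq_le {p k : ℕ} {r : ℝ} {𝒟 : Set ℝ} {μ : Measure (Fin p → ℝ)}
    (h : IsSignalLaw k r 𝒟 μ) (hb : 0 < bMin 𝒟) : k * bMin 𝒟 ^ 2 ≤ r ^ 2 := by
  have := h.prob
  obtain ⟨v, hk, hr, he⟩ := (h.sparse.and (h.norm_eq.and h.entries)).exists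
  have h0 : 0 ≤ ∑ j, v j ^ 2 := Finset.sum_nonneg fun _ _ => sq_nonneg _
  rw [← hr, l2norm, Real.sq_sqrt h0, ← hk]
  calc ((supp v).card : ℝ) * bMin 𝒟 ^ 2 = ∑ j ∈ supp v, bMin 𝒟 ^ 2 := by simp
    _ ≤ ∑ j ∈ supp v, v j ^ 2 := by
        refine Finset.sum_le_sum fun j hj => ?_
        rw [← sq_abs (v j)]
        refine pow_le_pow_left₀ hb.le (csInf_le ⟨0, ?_⟩ ⟨v j, he j (mem_supp.1 hj), rfl⟩) 2
        rintro _ ⟨x, _, rfl⟩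
        exact abs_nonneg x
    _ ≤ ∑ j, v j ^ 2 :=
        Finset.sum_le_sum_of_subset_of_nonneg (Finset.subset_univ _) fun _ _ _ => sq_nonneg _

/-- The size of the overlap of the supports of two signals. -/
def overlap {p : ℕ} (v v' : Fin p → ℝ) : ℝ := ((supp v ∩ supp v').card : ℝ)

lemma overlap_eq_sum {p : ℕ} (v v' : Fin p → ℝ) :
    overlap v v' = ∑ j, (if v j ≠ 0 then 1 else 0) * (if v' j ≠ 0 then 1 else 0) := by
  rw [overlap, Finset.card_eq_sum_ones, ← Finset.sum_filter_add_sum_filter_not Finset.univ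
    (fun j => j ∈ supp v ∩ supp v'), Finset.sum_eq_zero (s := Finset.univ.filter fun j => ¬ _)]
  · simp only [Finset.filter_univ_mem, add_zero, Nat.cast_sum, Nat.cast_one]
    refine Finset.sum_congr rfl fun j hj => ?_
    rw [Finset.mem_inter, mem_supp, mem_supp] at hj
    simp [hj.1, hj.2]
  · intro j hj
    simp only [Finset.mem_filter, Finset.mem_inter, mem_supp, not_and] at hj
    by_cases h : v j = 0
    · simp [h]
    · have := hj.2 h
      simp_all

/-- Only common support coordinates contribute, each at most B². This discards the unknown
dependence of the entries on the support. -/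
lemma abs_sum_mul_le_overlap {p : ℕ} {v v' : Fin p → ℝ} {B : ℝ} (hv : ‖v‖ ≤ B) (hv' : ‖v'‖ ≤ B) :
    |∑ j, v j * v' j| ≤ B ^ 2 * overlap v v' := by
  have hB : 0 ≤ B := (norm_nonneg v).trans hv
  rw [overlap_eq_sum, Finset.mul_sum]
  refine (Finset.abs_sum_le_sum_abs _ _).trans (Finset.sum_le_sum fun j _ => ?_)
  by_cases h : v j = 0
  · simp [h]
  by_cases h' : v' j = 0
  · simp [h']
  rw [if_pos h, if_pos h', abs_mul, sq, mul_one, mul_one]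
  exact mul_le_mul ((norm_le_pi_norm v j).trans hv) ((norm_le_pi_norm v' j).trans hv')
    (abs_nonneg _) hB

lemma measurable_overlap {p : ℕ} :
    Measurable fun u : (Fin p → ℝ) × (Fin p → ℝ) => overlap u.1 u.2 := by
  simp only [overlap_eq_sum]
  have h : ∀ j : Fin p, Measurable fun v : Fin p → ℝ => if v j ≠ 0 then (1 : ℝ) else 0 := fun j =>
    Measurable.ite (measurable_pi_apply j (measurableSet_singleton 0)).compl measurable_const
      measurable_const
  exact Finset.measurable_sum _ fun j _ =>
    ((h j).comp measurable_fst).mul ((h j).comp measurable_snd)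

lemma overlap_nonneg {p : ℕ} (v v' : Fin p → ℝ) : 0 ≤ overlap v v' := Nat.cast_nonneg _

lemma overlap_le {p : ℕ} (v v' : Fin p → ℝ) : overlap v v' ≤ p := by
  have := Finset.card_le_univ (supp v ∩ supp v')
  rw [Fintype.card_fin] at this
  exact Nat.cast_le.2 this

/-- The exponential moment of the overlap of a fixed support with a random one. -/
lemma IsSignalLaw.integral_exp_overlap_le {p k : ℕ} {r : ℝ} {𝒟 : Set ℝ} {μ : Measure (Fin p → ℝ)}
    (h : IsSignalLaw k r 𝒟 μ) (hk : (k : ℝ) ≤ Real.sqrt (p / Real.exp 1)) {v : Fin p → ℝ}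
    (hv : (supp v).card = k) : ∫ v', Real.exp (overlap v v') ∂μ ≤ 3 := by
  have he : 0 < Real.exp 1 := Real.exp_pos 1
  have he1 : 1 ≤ Real.exp 1 := Real.one_le_exp zero_le_one
  have hk2 : (k : ℝ) ^ 2 * Real.exp 1 ≤ p := by
    have := pow_le_pow_left₀ (Nat.cast_nonneg k) hk 2
    rwa [Real.sq_sqrt (by positivity), le_div_iff₀ he] at this
  have hkp : k ≤ p := by
    have h1 : (k : ℝ) ^ 2 ≤ p := by nlinarith [sq_nonneg (k : ℝ)]
    have h2 : k ^ 2 ≤ p := by exact_mod_cast h1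
    nlinarith [sq_nonneg k]
  have h1 := h.integral_supp fun S' => (1 + (Real.exp 1 - 1)) ^ (supp v ∩ S').card
  -- The hypergeometric moment is used at x = e - 1.
  have h2 : ∀ v' : Fin p → ℝ, Real.exp (overlap v v') =
      (1 + (Real.exp 1 - 1)) ^ (supp v ∩ supp v').card := by
    intro v'
    rw [add_sub_cancel, ← Real.exp_nat_mul, mul_one, overlap]
  simp only [h2]
  rw [h1, div_le_iff₀ (by exact_mod_cast Nat.choose_pos hkp), mul_comm]
  refine (sum_powersetCard_pow_le hkp hv (sub_nonneg.2 he1)).trans ?_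
  refine mul_le_mul_of_nonneg_left ?_ (Nat.cast_nonneg _)
  have h3 : 1 + (Real.exp 1 - 1) * ((k : ℝ) / p) ≤ Real.exp ((Real.exp 1 - 1) * ((k : ℝ) / p)) := by
    rw [add_comm]; exact Real.add_one_le_exp _
  -- Here k² e ≤ p enters; the moment is thus at most e.
  have h4 : (k : ℝ) * ((Real.exp 1 - 1) * ((k : ℝ) / p)) ≤ 1 := by
    rcases Nat.eq_zero_or_pos p with hp | hp
    · simp [hp]
    have hp' : (0 : ℝ) < p := by exact_mod_cast hp
    rw [← mul_div_assoc, ← mul_div_assoc, div_le_one hp']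
    nlinarith [sq_nonneg (k : ℝ)]
  calc (1 + (Real.exp 1 - 1) * ((k : ℝ) / p)) ^ k
      ≤ Real.exp ((Real.exp 1 - 1) * ((k : ℝ) / p)) ^ k := by
        refine pow_le_pow_left₀ ?_ h3 k
        have := sub_nonneg.2 he1
        positivity
    _ = Real.exp (k * ((Real.exp 1 - 1) * ((k : ℝ) / p))) := (Real.exp_nat_mul _ k).symm
    _ ≤ Real.exp 1 := Real.exp_le_exp.2 h4
    _ ≤ 3 := Real.exp_one_lt_d9.le.trans (by norm_num)

lemma IsJointPrior.isProbabilityMeasure {p k : ℕ} {r : ℝ} {𝒟 : Set ℝ}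
    {π : Measure ((Fin p → ℝ) × (Fin p → ℝ))} (h : IsJointPrior k r 𝒟 π) :
    IsProbabilityMeasure π := by
  have := h.fst.prob
  exact Measure.isProbabilityMeasure_of_map (μ := π) (f := Prod.fst)

/-- The low-degree divergence of the symmetric balanced problem is bounded by a constant. -/
theorem chiSqLE_le_three {p n k D : ℕ} {σ r B : ℝ} {𝒟 : Set ℝ}
    {π : Measure ((Fin p → ℝ) × (Fin p → ℝ))} (hσ : 0 < σ) (hπ : IsJointPrior k r 𝒟 π)
    (hs : ∀ᵐ b ∂π, b.1 = -b.2) (hB : ∀ᵐ b ∂π, ‖b.1‖ ≤ B)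
    (hk : (k : ℝ) ≤ Real.sqrt (p / Real.exp 1))
    (hD : (D : ℝ) ≤ 2 * (Real.sqrt 2 - 1) * min ((r ^ 2 + σ ^ 2) ^ 2 / (n * B ^ 4)) (n : ℝ)) :
    chiSqLE D (planted n σ (1 / 2) π) (null n p σ r) ≤ 3 := by
  have := hπ.isProbabilityMeasure
  have hr : ∀ᵐ b ∂π, ∑ j, b.1 j ^ 2 = r ^ 2 := by
    filter_upwards [ae_of_ae_map measurable_fst.aemeasurable hπ.fst.norm_eq] with b hb
    rw [← hb, l2norm, Real.sq_sqrt (Finset.sum_nonneg fun _ _ => sq_nonneg _)]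
  have hsp : ∀ᵐ b ∂π, (supp b.1).card = k :=
    ae_of_ae_map measurable_fst.aemeasurable hπ.fst.sparse
  refine (chiSqLE_le_coeffEnergy hσ hB hs hr).trans ?_
  rw [show (3 : ℝ≥0∞) = ENNReal.ofReal 3 by simp]
  refine ENNReal.ofReal_le_ofReal ?_
  rw [coeffEnergy_eq hB]
  set s := σ * Real.sqrt (r ^ 2 / σ ^ 2 + 1) with hsdef
  have hs2 : s ^ 2 = r ^ 2 + σ ^ 2 := by
    rw [hsdef, mul_pow, Real.sq_sqrt (by positivity)]
    field_simp
  have hs0 : 0 < r ^ 2 + σ ^ 2 := by positivity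
  have hq : 0 ≤ 2 * (Real.sqrt 2 - 1) := by
    have : 1 ≤ Real.sqrt 2 := Real.one_le_sqrt.2 (by norm_num)
    linarith
  have hint : Integrable (fun u : ((Fin p → ℝ) × (Fin p → ℝ)) × ((Fin p → ℝ) × (Fin p → ℝ)) =>
      Real.exp (overlap u.1.1 u.2.1)) (π.prod π) := by
    refine (HasMoments.of_bound ?_ (Real.exp p) (ae_of_all _ fun u => ?_)).integrable
    · exact (Real.measurable_exp.comp (measurable_overlap.comp
        ((measurable_fst.comp measurable_fst).prodMk
          (measurable_fst.comp measurable_snd)))).aestronglyMeasurable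
    · rw [Real.abs_exp]
      exact Real.exp_le_exp.2 (overlap_le _ _)
  have hB1 : ∀ᵐ u ∂π.prod π, ‖u.1.1‖ ≤ B := Measure.quasiMeasurePreserving_fst.ae hB
  have hB2 : ∀ᵐ u ∂π.prod π, ‖u.2.1‖ ≤ B := Measure.quasiMeasurePreserving_snd.ae hB
  refine (integral_mono_of_nonneg (ae_of_all _ fun u => Finset.sum_nonneg fun d _ => ?_) hint
    ?_).trans ?_
  · rw [pow_mul]; positivity
  · filter_upwards [hB1, hB2] with u h1 h2
    -- With z the overlap and A the first term of the minimum, n A t² ≤ z² is the square of the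
    -- bound of the inner product by B² z.
    refine sum_exponents_le_exp (A := (r ^ 2 + σ ^ 2) ^ 2 / (n * B ^ 4)) (overlap_nonneg _ _) ?_
      (hD.trans (mul_le_mul_of_nonneg_left (min_le_right _ _) hq))
      (hD.trans (mul_le_mul_of_nonneg_left (min_le_left _ _) hq))
    have ht : ∑ j, u.1.1 j / s * (u.2.1 j / s) = (∑ j, u.1.1 j * u.2.1 j) / (r ^ 2 + σ ^ 2) := by
      rw [← hs2, Finset.sum_div]
      exact Finset.sum_congr rfl fun j _ => by rw [div_mul_div_comm, sq]
    have habs := pow_le_pow_left₀ (abs_nonneg _) (abs_sum_mul_le_overlap h1 h2) 2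
    rw [sq_abs, mul_pow, ← pow_mul] at habs
    rw [ht]
    rcases eq_or_ne (n * B ^ 4 : ℝ) 0 with h0 | h0
    -- If n B⁴ = 0, the quotient A is 0 by convention and the left side vanishes.
    · rw [h0, div_zero, mul_zero, zero_mul]; positivity
    · have hn : (n : ℝ) ≠ 0 := left_ne_zero_of_mul h0
      have hB4 : B ^ 4 ≠ 0 := right_ne_zero_of_mul h0
      have hB4' : 0 < B ^ 4 := lt_of_le_of_ne (by positivity) hB4.symm
      calc n * ((r ^ 2 + σ ^ 2) ^ 2 / (n * B ^ 4)) *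
            ((∑ j, u.1.1 j * u.2.1 j) / (r ^ 2 + σ ^ 2)) ^ 2
          = (∑ j, u.1.1 j * u.2.1 j) ^ 2 / B ^ 4 := by field_simp
        _ ≤ overlap u.1.1 u.2.1 ^ 2 := by
          rw [div_le_iff₀ hB4', mul_comm]
          exact habs
  -- The moment bound holds conditionally on the first signal, of which only the support size
  -- matters.
  · rw [integral_prod _ hint]
    refine (integral_mono_of_nonneg (ae_of_all _ fun b => integral_nonneg fun _ =>
      (Real.exp_pos _).le) (integrable_const 3) ?_).trans_eq (by simp)
    filter_upwards [hsp] with b hb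
    have h1 := hπ.fst.integral_exp_overlap_le hk hb
    have h2 : Measurable fun v' : Fin p → ℝ => Real.exp (overlap b.1 v') :=
      (measurable_overlap.comp (measurable_prodMk_left (x := b.1))).exp
    rwa [integral_map measurable_fst.aemeasurable h2.aestronglyMeasurable] at h1

/-! ### Sequences of problems of bounded amplitude -/

namespace Params.InRegime

variable {S : Params} {K : ℝ}

/-- From k β_min² ≤ r² follows k²/r⁴ ≤ 1/β_min⁴, which replaces the sparsity in `nAlg` by the
amplitude B = max(K, 1)·β_min, at the cost of max(K, 1)⁴. The maximum keeps B positive for every K.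
-/
lemma nAlg_div_le (h : S.InRegime K) (i : ℕ) :
    S.nAlg i / S.n i ≤ max K 1 ^ 4 *
      ((S.r i ^ 2 + S.σ i ^ 2) ^ 2 / (S.n i * (max K 1 * bMin (S.𝒟 i)) ^ 4)) := by
  have hb := (h.prior i).bMin_pos
  have hkr := (h.prior i).fst.mul_bMin_sq_le hb
  have hσ := h.σ_pos i
  have hK : 0 < max K 1 := lt_max_of_lt_right one_pos
  -- The case k = 0 is separate because r² > 0 below is deduced from k > 0.
  rcases Nat.eq_zero_or_pos (S.k i) with hk | hk
  · rw [nAlg, hk]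
    simp only [Nat.cast_zero, ne_eq, OfNat.ofNat_ne_zero, not_false_eq_true, zero_pow, zero_mul,
      zero_div]
    positivity
  have hk' : (0 : ℝ) < S.k i := by exact_mod_cast hk
  have hr : 0 < S.r i ^ 2 := lt_of_lt_of_le (by positivity) hkr
  have h1 : S.nAlg i = (S.k i : ℝ) ^ 2 * (S.r i ^ 2 + S.σ i ^ 2) ^ 2 / (S.r i ^ 2) ^ 2 := by
    rw [nAlg, snr]
    field_simp
  have h2 : (S.k i : ℝ) ^ 2 / (S.r i ^ 2) ^ 2 ≤ 1 / bMin (S.𝒟 i) ^ 4 := by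
    rw [div_le_div_iff₀ (by positivity) (by positivity), one_mul]
    calc (S.k i : ℝ) ^ 2 * bMin (S.𝒟 i) ^ 4 = (S.k i * bMin (S.𝒟 i) ^ 2) ^ 2 := by ring
      _ ≤ (S.r i ^ 2) ^ 2 := pow_le_pow_left₀ (by positivity) hkr 2
  calc S.nAlg i / S.n i
      = (S.k i : ℝ) ^ 2 / (S.r i ^ 2) ^ 2 * ((S.r i ^ 2 + S.σ i ^ 2) ^ 2 / S.n i) := by
        rw [h1]; ring
    _ ≤ 1 / bMin (S.𝒟 i) ^ 4 * ((S.r i ^ 2 + S.σ i ^ 2) ^ 2 / S.n i) := by gcongr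
    _ = _ := by
        rcases eq_or_ne (S.n i : ℝ) 0 with hn | hn
        · simp [hn]
        · field_simp

lemma rate_div_le (h : S.InRegime K) (i : ℕ) :
    S.rate i / max K 1 ^ 4 ≤
      min ((S.r i ^ 2 + S.σ i ^ 2) ^ 2 / (S.n i * (max K 1 * bMin (S.𝒟 i)) ^ 4)) (S.n i : ℝ) := by
  have hK : 1 ≤ max K 1 ^ 4 := one_le_pow₀ (le_max_right _ _)
  rw [div_le_iff₀ (by linarith)]
  rcases le_total ((S.r i ^ 2 + S.σ i ^ 2) ^ 2 / (S.n i * (max K 1 * bMin (S.𝒟 i)) ^ 4))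
    (S.n i : ℝ) with h1 | h1
  · rw [min_eq_left h1, mul_comm]
    exact (min_le_left _ _).trans (h.nAlg_div_le i)
  · rw [min_eq_right h1]
    exact (min_le_right _ _).trans (le_mul_of_one_le_right (Nat.cast_nonneg _) hK)

lemma eventually_k_le (h : S.InRegime K) :
    ∀ᶠ i in atTop, (S.k i : ℝ) ≤ Real.sqrt (S.p i / Real.exp 1) := by
  have hc : 0 < (Real.sqrt (Real.exp 1))⁻¹ := inv_pos.2 (Real.sqrt_pos.2 (Real.exp_pos 1))
  filter_upwards [h.k_small.bound hc] with i hi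
  rw [Real.norm_of_nonneg (Nat.cast_nonneg _), Real.norm_of_nonneg (Real.sqrt_nonneg _)] at hi
  rwa [Real.sqrt_div (Nat.cast_nonneg _), div_eq_inv_mul]

/-- The divergence is bounded for degrees up to a small multiple of the rate. -/
theorem chiSqBounded (h : S.InRegime K) (D : ℕ → ℕ)
    (hD : ∀ᶠ i in atTop, (D i : ℝ) ≤ 2 * (Real.sqrt 2 - 1) / max K 1 ^ 4 * S.rate i) :
    S.problem.ChiSqBounded D := by
  refine ⟨3, ?_⟩
  have hq : 0 ≤ 2 * (Real.sqrt 2 - 1) := by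
    have : 1 ≤ Real.sqrt 2 := Real.one_le_sqrt.2 (by norm_num)
    linarith
  filter_upwards [hD, h.eventually_k_le] with i hi hk
  refine chiSqLE_le_three (B := max K 1 * bMin (S.𝒟 i)) (h.σ_pos i) (h.prior i) (h.symmetric i) ?_
    hk ?_
  · filter_upwards [h.amplitude i] with b hb
    exact hb.trans (mul_le_mul_of_nonneg_right (le_max_left _ _) (h.prior i).bMin_pos.le)
  · refine hi.trans ?_
    rw [div_mul_eq_mul_div, mul_div_assoc]
    exact mul_le_mul_of_nonneg_left (h.rate_div_le i) hq

lemma eventually_log_p_ge (h : S.InRegime K) (C : ℝ) :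
    ∀ᶠ i in atTop, C ≤ Real.log (S.p i) :=
  (Real.tendsto_log_atTop.comp (tendsto_natCast_atTop_atTop.comp h.p_tendsto)).eventually_ge_atTop C

/-- The rate grows faster than `log p`. -/
lemma log_p_isLittleO_rate (h : S.InRegime K) :
    (fun i => Real.log (S.p i)) =o[atTop] S.rate := by
  refine isLittleO_iff.2 fun ε hε => ?_
  filter_upwards [h.n_large.bound hε, h.n_small.bound hε, h.eventually_log_p_ge 1] with i h1 h2 h3
  have hl : 0 < Real.log (S.p i) := by linarith
  have hA : 0 ≤ S.nAlg i := by unfold nAlg; positivity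
  rw [Real.norm_of_nonneg (Nat.cast_nonneg _)] at h1 h2
  rw [Real.norm_of_nonneg (by positivity)] at h2
  have h4 : Real.log (S.p i) ≤ ε * S.n i := ((le_max_right _ _).trans (le_abs_self _)).trans h1
  have hn : (0 : ℝ) < S.n i := by
    by_contra hn
    nlinarith
  -- The upper bound on n, with n and log p exchanged, handles the first term of the minimum; the
  -- lower bound on n handles the second.
  have h5 : Real.log (S.p i) ≤ ε * (S.nAlg i / S.n i) := by
    rw [← mul_div_assoc, le_div_iff₀ hn, mul_comm]
    rwa [← mul_div_assoc, le_div_iff₀ hl] at h2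
  rw [Real.norm_of_nonneg hl.le, rate, Real.norm_of_nonneg (le_min (by positivity) hn.le),
    mul_min_of_nonneg _ _ hε.le]
  exact le_min h5 h4

lemma log_N_isBigO (h : S.InRegime K)
    (hn : (fun i => Real.log (S.n i)) =O[atTop] (fun i => Real.log (S.p i))) :
    (fun i => Real.log (S.problem.N i)) =O[atTop] (fun i => Real.log (S.p i)) := by
  have hp1 : (fun i => Real.log ((S.p i : ℝ) + 1)) =O[atTop] (fun i => Real.log (S.p i)) := by
    -- For p ≥ 2 one has p + 1 ≤ p².
    refine IsBigO.of_bound 2 ?_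
    filter_upwards [h.p_tendsto.eventually_ge_atTop 2] with i hi
    have hp : (2 : ℝ) ≤ S.p i := by exact_mod_cast hi
    rw [Real.norm_of_nonneg (Real.log_nonneg (by linarith)),
      Real.norm_of_nonneg (Real.log_nonneg (by linarith)), ← Real.log_rpow (by linarith)]
    refine Real.log_le_log (by linarith) ?_
    norm_num
    nlinarith
  refine (hn.add hp1).congr' ?_ EventuallyEq.rfl
  filter_upwards [h.n_large.bound one_pos, h.eventually_log_p_ge 1] with i h1 h2
  have h4 : Real.log (S.p i) ≤ S.n i := by
    rw [Real.norm_of_nonneg (Nat.cast_nonneg _), one_mul] at h1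
    exact ((le_max_right _ _).trans (le_abs_self _)).trans h1
  have hn0 : (S.n i : ℝ) ≠ 0 := by linarith
  simp only [problem]
  rw [Nat.cast_mul, Real.log_mul hn0 (by positivity)]
  push_cast
  rfl

/-- Under the low-degree conjecture, strong detection takes time exponential in the rate. -/
theorem requiresExpTime (h : S.InRegime K)
    (hn : (fun i => Real.log (S.n i)) =O[atTop] (fun i => Real.log (S.p i)))
    (hLD : S.problem.LowDegreeConjecture) : S.problem.RequiresExpTime S.rate := by
  set c := 2 * (Real.sqrt 2 - 1) / max K 1 ^ 4 with hcdef
  have hc : 0 < c := by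
    have h1 : 1 < Real.sqrt 2 := by rw [Real.lt_sqrt (by norm_num)]; norm_num
    have h2 : 0 < max K 1 := lt_max_of_lt_right one_pos
    have h3 := sub_pos.2 h1
    positivity
  have hrate : ∀ᶠ i in atTop, 2 / c ≤ S.rate i := by
    filter_upwards [h.log_p_isLittleO_rate.bound one_pos, h.eventually_log_p_ge (2 / c)] with i h1 h2
    have hr : 0 ≤ S.rate i := by unfold rate nAlg; positivity
    rw [one_mul, Real.norm_of_nonneg hr] at h1
    exact h2.trans ((le_abs_self _).trans h1)
  have hr0 : ∀ i, 0 ≤ S.rate i := fun i => by unfold rate nAlg; positivity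
  -- The largest degree covered by `chiSqBounded`. Once c·`rate` ≥ 2, rounding down costs at most a
  -- factor 2.
  let D : ℕ → ℕ := fun i => ⌊c * S.rate i⌋₊
  have hDle : ∀ i, (D i : ℝ) ≤ c * S.rate i := fun i =>
    Nat.floor_le (mul_nonneg hc.le (hr0 i))
  have hDge : ∀ᶠ i in atTop, c / 2 * S.rate i ≤ D i := by
    filter_upwards [hrate] with i hi
    have h1 : c * S.rate i < D i + 1 := Nat.lt_floor_add_one _
    rw [div_le_iff₀ hc] at hi
    linarith
  have hDO : S.rate =O[atTop] fun i => (D i : ℝ) := by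
    refine IsBigO.of_bound (2 / c) ?_
    filter_upwards [hDge] with i hi
    rw [Real.norm_of_nonneg (hr0 i), Real.norm_of_nonneg (Nat.cast_nonneg _), div_mul_eq_mul_div,
      le_div_iff₀ hc]
    linarith
  -- The chain log N = O(log p), log p = o(`rate`), `rate` = O(D) shows D = ω(log N).
  have hexp := hLD D (((h.log_N_isBigO hn).trans_isLittleO h.log_p_isLittleO_rate).trans_isBigO hDO)
    (h.chiSqBounded D (Eventually.of_forall hDle))
  intro A T hA
  obtain ⟨c', a, hc', hT⟩ := hexp A T hA
  refine ⟨c' * (c / 2), a, by positivity, ?_⟩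
  filter_upwards [hT, hDge] with i h1 h2
  refine le_trans (Real.exp_le_exp.2 ?_) h1
  refine div_le_div_of_nonneg_right ?_ (pow_nonneg (Real.log_natCast_nonneg _) a)
  rw [mul_assoc]
  exact mul_le_mul_of_nonneg_left h2 hc'.le

end Params.InRegime

end MSLR

end

theorem mainTheorem1 :
    -- the general bound, with a constant that depends on nothing
    (∃ M : ℝ≥0, ∀ (p n k D : ℕ) (σ r B : ℝ) (𝒟 : Set ℝ)
      (π : Measure ((Fin p → ℝ) × (Fin p → ℝ))),
      0 < σ → IsJointPrior k r 𝒟 π → (∀ᵐ b ∂π, b.1 = -b.2) → (∀ᵐ b ∂π, ‖b.1‖ ≤ B) →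
      (k : ℝ) ≤ Real.sqrt (p / Real.exp 1) → k ≤ D →
      (D : ℝ) ≤ 2 * (Real.sqrt 2 - 1) * min ((r ^ 2 + σ ^ 2) ^ 2 / (n * B ^ 4)) (n : ℝ) →
      chiSqLE D (planted n σ (1 / 2) π) (null n p σ r) ≤ M) ∧
    -- the bound and the running time in the regime of bounded amplitude and `k = o(√p)`
    (∀ K : ℝ, ∃ c : ℝ, 0 < c ∧ ∀ S : Params, S.InRegime K →
      (∀ D : ℕ → ℕ, (∀ᶠ i in atTop, (D i : ℝ) ≤ c * S.rate i) → S.problem.ChiSqBounded D) ∧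
      ((fun i => Real.log (S.n i)) =O[atTop] (fun i => Real.log (S.p i)) →
        S.problem.LowDegreeConjecture → S.problem.RequiresExpTime S.rate)) := by
  refine ⟨⟨3, fun p n k D σ r B 𝒟 π hσ hπ hs hB hk _ hD => ?_⟩, fun K => ?_⟩
  · exact chiSqLE_le_three hσ hπ hs hB hk hD
  · have h1 : 1 < Real.sqrt 2 := by rw [Real.lt_sqrt (by norm_num)]; norm_num
    have h2 : 0 < max K 1 := lt_max_of_lt_right one_pos
    have h3 := sub_pos.2 h1
    -- The fourth power comes from B⁴ with B = max(K, 1)·β_min.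
    exact ⟨2 * (Real.sqrt 2 - 1) / max K 1 ^ 4, by positivity, fun S h =>
      ⟨h.chiSqBounded, h.requiresExpTime⟩⟩
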